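/- All rings are commutative and Noetherian. Let $(S,\mathfrak m_S)$ and $(T,\mathfrak m_T)$ be local rings with common residue field $k$, neither of which is a field, and let $\pi_S\colon S\to k$, $\pi_T\colon T\to k$ be the natural surjections. Let $R$ be a local ring isomorphic to the fibre product $S\times_k T=\{(s,t)\in S\times T \mid \pi_S(s)=\pi_T(t)\}$. An ideal $I$ of a local ring $(A,\mathfrak n)$ is called a Burch ideal if $\mathfrak n I\neq\mathfrak n(I:_A\mathfrak n)$. A local ring $B$ of depth $t$, with completion $\widehat B$ with respect to its maximal ideal, is called a Burch ring if there exist a maximal $\widehat B$-regular sequence $x_1,\dots,x_t$ in $\widehat B$, a regular local ring $A$ and a Burch ideal $I$ of $A$ such that $\widehat B/(x_1,\dots,x_t)\cong A/I$. Then $R$ is a Burch ring if and only if one of the following holds: (a) $\operatorname{depth} R>0$; (b) $\operatorname{depth} R=0$, and $S$ is a Burch ring of depth zero or $T$ is a Burch ring of depth zero. -/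

import Mathlib

universe u

namespace Burch

open IsLocalRing

/-- The depth of a local ring `(R, 𝔪)`: the supremum of the lengths of the `R`-regular sequences
contained in `𝔪`. -/
noncomputable def depth (R : Type*) [CommRing R] [IsLocalRing R] : ℕ∞ :=
  ⨆ rs ∈ {rs : List R | (∀ r ∈ rs, r ∈ maximalIdeal R) ∧ RingTheory.Sequence.IsRegular R rs},
    (rs.length : ℕ∞)

/-- An ideal `I` of a local ring `(R, 𝔪)` is a Burch ideal if `𝔪 I ≠ 𝔪 (I : 𝔪)`. -/
def IsBurchIdeal {R : Type*} [CommRing R] [IsLocalRing R] (I : Ideal R) : Prop :=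
  maximalIdeal R * I ≠ maximalIdeal R * I.colon (maximalIdeal R : Set R)

/-- The `𝔪`-adic completion of a local ring `(R, 𝔪)`. -/
abbrev Completion (R : Type*) [CommRing R] [IsLocalRing R] : Type _ :=
  AdicCompletion (maximalIdeal R) R

/-- A local ring `R` of depth `t` is Burch if there are a maximal regular sequence
`x₁, …, x_t` in the completion of `R`, a regular local ring `A` and a Burch ideal `I` of `A` such
that the quotient of the completion by `(x₁, …, x_t)` is isomorphic to `A ⧸ I`. -/
def IsBurchRing (R : Type u) [CommRing R] [IsLocalRing R] : Prop :=
  ∃ xs : List (Completion R),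
    RingTheory.Sequence.IsRegular (Completion R) xs ∧
    (∀ y : Completion R, ¬ RingTheory.Sequence.IsRegular (Completion R) (xs ++ [y])) ∧
    (xs.length : ℕ∞) = depth R ∧
    ∃ (A : Type u) (_ : CommRing A) (_ : IsRegularLocalRing A) (I : Ideal A),
      IsBurchIdeal I ∧ Nonempty ((Completion R ⧸ Ideal.ofList xs) ≃+* (A ⧸ I))

/-- The fibre product `S ×ₖ T = {(s, t) ∈ S × T | πS s = πT t}`. -/
def fibreProduct {S T k : Type*} [CommRing S] [CommRing T] [Field k]
    (πS : S →+* k) (πT : T →+* k) : Subring (S × T) :=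
  (πS.comp (RingHom.fst S T)).eqLocus (πT.comp (RingHom.snd S T))

end Burch

/-! ### Symmetric pairings on the maximal ideal, and socle products in its symmetric square -/

namespace Burch

open IsLocalRing TensorProduct

/-! The Burch property in depth zero is intrinsic. For a local ring Q with maximal ideal m,
`SocleSymmSqNeZero Q` says that some product z·x in Sym²(m), with z ∈ m in the socle and x ∈ m, is
nonzero. If Q = A/I with I inside the maximal ideal n of A, multiplication of lifts maps Sym²(m) to
n²/nI, and socle products go to classes of n(I : n). When n is generated by a regular sequence,
Sym²(n) ≅ n² and this map is an isomorphism. So the invariant holds exactly when I is Burch,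
provided Q is not a field (`SocleSymmSqNeZero.of_isBurchIdeal`, `SocleSymmSqNeZero.isBurchIdeal`).
Nonvanishing in Sym² is always exhibited by a suitable pairing.

The invariant is unchanged by completion (`IsCompletionLike.socleSymmSqNeZero_iff`), and Cohen's
structure theorem (`exists_regular_surjection`) supplies the regular presentation. Hence a non-field
R is Burch of depth zero iff it satisfies the invariant (`isBurchRing_and_depth_eq_zero_iff`).

For a fibre product, m_R = m_S ⊕ m_T with m_S m_T = 0, so Sym²(m_R) is Sym²(m_S) ⊕ Sym²(m_T) plus
the mixed part m_S/m_S² ⊗ m_T/m_T². A socle element of S with a nonzero mixed product lies outside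
m_S², and then already z² ≠ 0 in Sym²(m_S). So the invariant of R is the disjunction of those of S
and T.

In positive depth the depth is one. Prime avoidance gives a regular r = (s, t) with s ∉ m_S² and t ∉
m_T². Modulo r the element (s, 0) is in the socle but outside the square of the maximal ideal, so
the quotient satisfies the invariant. -/

/-- A biadditive, balanced and symmetric pairing on the maximal ideal of a local ring, given by a
function whose values outside the maximal ideal are irrelevant. -/
structure IsSymmPairing {Q M : Type*} [CommRing Q] [IsLocalRing Q] [AddCommGroup M]
    (β : Q → Q → M) : Prop where
  add_left : ∀ x ∈ maximalIdeal Q, ∀ x' ∈ maximalIdeal Q, ∀ y ∈ maximalIdeal Q,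
    β (x + x') y = β x y + β x' y
  symm : ∀ x ∈ maximalIdeal Q, ∀ y ∈ maximalIdeal Q, β x y = β y x
  mul_left : ∀ r, ∀ x ∈ maximalIdeal Q, ∀ y ∈ maximalIdeal Q, β (r * x) y = β x (r * y)

namespace IsSymmPairing

variable {Q M : Type*} [CommRing Q] [IsLocalRing Q] [AddCommGroup M] {β : Q → Q → M}

lemma add_right (h : IsSymmPairing β) {x y y' : Q} (hx : x ∈ maximalIdeal Q)
    (hy : y ∈ maximalIdeal Q) (hy' : y' ∈ maximalIdeal Q) :
    β x (y + y') = β x y + β x y' := by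
  rw [h.symm _ hx _ (add_mem hy hy'), h.add_left _ hy _ hy' _ hx, h.symm _ hy _ hx,
    h.symm _ hy' _ hx]

lemma zero_left (h : IsSymmPairing β) {y : Q} (hy : y ∈ maximalIdeal Q) : β 0 y = 0 := by
  have := h.add_left 0 (zero_mem _) 0 (zero_mem _) y hy
  simpa using this

lemma zero_right (h : IsSymmPairing β) {y : Q} (hy : y ∈ maximalIdeal Q) : β y 0 = 0 := by
  rw [h.symm _ hy _ (zero_mem _), h.zero_left hy]

lemma sub_left (h : IsSymmPairing β) {x x' y : Q} (hx : x ∈ maximalIdeal Q)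
    (hx' : x' ∈ maximalIdeal Q) (hy : y ∈ maximalIdeal Q) :
    β (x - x') y = β x y - β x' y := by
  have := h.add_left (x - x') (sub_mem hx hx') x' hx' y hy
  rw [sub_add_cancel] at this
  rw [this, add_sub_cancel_right]

lemma comp {R : Type*} [CommRing R] [IsLocalRing R] (h : IsSymmPairing β) (f : R →+* Q)
    (hf : ∀ x ∈ maximalIdeal R, f x ∈ maximalIdeal Q) :
    IsSymmPairing fun x y => β (f x) (f y) where
  add_left x hx x' hx' y hy := by
    simp only [map_add]
    exact h.add_left _ (hf x hx) _ (hf x' hx') _ (hf y hy)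
  symm x hx y hy := h.symm _ (hf x hx) _ (hf y hy)
  mul_left r x hx y hy := by
    simp only [map_mul]
    exact h.mul_left _ _ (hf x hx) _ (hf y hy)

/-- An element killed by the maximal ideal pairs trivially with the square of the maximal ideal. -/
lemma eq_zero_of_mem_sq (h : IsSymmPairing β) {z x : Q} (hz : z ∈ maximalIdeal Q)
    (hz0 : ∀ y ∈ maximalIdeal Q, y * z = 0) (hx : x ∈ maximalIdeal Q ^ 2) : β z x = 0 := by
  rw [pow_two] at hx
  refine (Submodule.mul_induction_on (C := fun x => x ∈ maximalIdeal Q ∧ β z x = 0) hx ?_ ?_).2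
  · intro a ha b hb
    refine ⟨Ideal.mul_mem_left _ _ hb, ?_⟩
    rw [← h.mul_left a z hz b hb, hz0 a ha, h.zero_left hb]
  · rintro a b ⟨ha, ha'⟩ ⟨hb, hb'⟩
    exact ⟨add_mem ha hb, by rw [h.add_right hz ha hb, ha', hb', add_zero]⟩

end IsSymmPairing

section

variable (Q : Type*) [CommRing Q] [IsLocalRing Q]

/-- The relations defining the symmetric square of the maximal ideal. -/
def symmRel : Submodule Q (maximalIdeal Q ⊗[Q] maximalIdeal Q) :=
  Submodule.span Q (Set.range fun p : maximalIdeal Q × maximalIdeal Q =>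
    p.1 ⊗ₜ[Q] p.2 - p.2 ⊗ₜ[Q] p.1)

/-- Some socle element in the maximal ideal has a nonzero multiple in the symmetric square of the
maximal ideal. -/
def SocleSymmSqNeZero : Prop :=
  ∃ z x : maximalIdeal Q, (∀ y ∈ maximalIdeal Q, y * (z : Q) = 0) ∧ z ⊗ₜ[Q] x ∉ symmRel Q

end

section

variable {Q : Type*} [CommRing Q] [IsLocalRing Q]

/-- By the universal property of the symmetric square, any pairing into an abelian group can detect
a nonzero product; the target need not be a module. -/
lemma SocleSymmSqNeZero.of_pairing {M : Type*} [AddCommGroup M] {β : Q → Q → M}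
    (h : IsSymmPairing β) {z x : Q} (hz : z ∈ maximalIdeal Q)
    (hz0 : ∀ y ∈ maximalIdeal Q, y * z = 0) (hx : x ∈ maximalIdeal Q) (hβ : β z x ≠ 0) :
    SocleSymmSqNeZero Q := by
  refine ⟨⟨z, hz⟩, ⟨x, hx⟩, hz0, fun hmem => hβ ?_⟩
  let f : maximalIdeal Q →+ maximalIdeal Q →+ M :=
    AddMonoidHom.mk' (fun a => AddMonoidHom.mk' (fun b => β a b)
      (fun b b' => by simpa using h.add_right a.2 b.2 b'.2))
      (fun a a' => by ext b; simpa using h.add_left a a.2 a' a'.2 b b.2)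
  have hf : ∀ (r : Q) (a b : maximalIdeal Q), f (r • a) b = f a (r • b) := fun r a b => by
    simpa [f] using h.mul_left r a a.2 b b.2
  let L := TensorProduct.liftAddHom f hf
  -- `L` is only additive, while `symmRel Q` is a `Q`-span, so the induction has to carry all
  -- multiples of `t`.
  have key : ∀ t ∈ symmRel Q, ∀ r : Q, L (r • t) = 0 := by
    intro t ht
    induction ht using Submodule.span_induction with
    | mem t ht =>
      obtain ⟨⟨a, b⟩, rfl⟩ := ht
      intro r
      rw [smul_sub, TensorProduct.smul_tmul', TensorProduct.smul_tmul', map_sub, sub_eq_zero]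
      change f (r • a) b = f (r • b) a
      rw [hf r b a]
      exact h.symm _ (r • a).2 _ b.2
    | zero => simp
    | add s t _ _ hs ht => intro r; rw [smul_add, map_add, hs, ht, add_zero]
    | smul c t _ ht => intro r; rw [smul_smul]; exact ht _
  have := key _ hmem 1
  rw [one_smul] at this
  exact this

open Classical in
/-- The universal symmetric pairing on the maximal ideal. -/
noncomputable def univPairing (x y : Q) :
    (maximalIdeal Q ⊗[Q] maximalIdeal Q) ⧸ symmRel Q :=
  if h : x ∈ maximalIdeal Q ∧ y ∈ maximalIdeal Q then
    (symmRel Q).mkQ ((⟨x, h.1⟩ : maximalIdeal Q) ⊗ₜ[Q] (⟨y, h.2⟩ : maximalIdeal Q)) else 0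

lemma univPairing_apply {x y : Q} (hx : x ∈ maximalIdeal Q) (hy : y ∈ maximalIdeal Q) :
    univPairing x y =
      (symmRel Q).mkQ ((⟨x, hx⟩ : maximalIdeal Q) ⊗ₜ[Q] (⟨y, hy⟩ : maximalIdeal Q)) :=
  dif_pos ⟨hx, hy⟩

lemma univPairing_mul_left (r : Q) {x y : Q} (hx : x ∈ maximalIdeal Q) (hy : y ∈ maximalIdeal Q) :
    univPairing (r * x) y = r • univPairing x y := by
  rw [univPairing_apply (Ideal.mul_mem_left _ _ hx) hy, univPairing_apply hx hy, ← map_smul,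
    TensorProduct.smul_tmul']
  rfl

lemma univPairing_mul_right (r : Q) {x y : Q} (hx : x ∈ maximalIdeal Q) (hy : y ∈ maximalIdeal Q) :
    univPairing x (r * y) = r • univPairing x y := by
  rw [univPairing_apply hx (Ideal.mul_mem_left _ _ hy), univPairing_apply hx hy, ← map_smul,
    ← TensorProduct.tmul_smul]
  rfl

lemma isSymmPairing_univPairing : IsSymmPairing (univPairing (Q := Q)) where
  add_left x hx x' hx' y hy := by
    rw [univPairing_apply (add_mem hx hx') hy, univPairing_apply hx hy, univPairing_apply hx' hy,
      ← map_add, ← TensorProduct.add_tmul]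
    rfl
  symm x hx y hy := by
    rw [univPairing_apply hx hy, univPairing_apply hy hx, ← sub_eq_zero, ← map_sub]
    rw [Submodule.mkQ_apply, Submodule.Quotient.mk_eq_zero]
    exact Submodule.subset_span ⟨(⟨x, hx⟩, ⟨y, hy⟩), rfl⟩
  mul_left r x hx y hy := by rw [univPairing_mul_left r hx hy, univPairing_mul_right r hx hy]

lemma SocleSymmSqNeZero.exists_univPairing_ne_zero (h : SocleSymmSqNeZero Q) :
    ∃ z ∈ maximalIdeal Q, (∀ y ∈ maximalIdeal Q, y * z = 0) ∧
      ∃ x ∈ maximalIdeal Q, univPairing z x ≠ 0 := by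
  obtain ⟨z, x, hz, hzx⟩ := h
  refine ⟨z, z.2, hz, x, x.2, ?_⟩
  rwa [univPairing_apply z.2 x.2, Submodule.mkQ_apply, Ne, Submodule.Quotient.mk_eq_zero]

/-- A socle element outside the square of the maximal ideal has nonzero symmetric square. -/
lemma SocleSymmSqNeZero.of_notMem_sq {z : Q} (hz : z ∈ maximalIdeal Q)
    (hz0 : ∀ y ∈ maximalIdeal Q, y * z = 0) (hz2 : z ∉ maximalIdeal Q ^ 2) :
    SocleSymmSqNeZero Q := by
  classical
  have hne : (maximalIdeal Q).toCotangent ⟨z, hz⟩ ≠ 0 := by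
    rwa [Ne, Ideal.toCotangent_eq_zero]
  -- A functional `l` on the cotangent space with `l z ≠ 0`; the pairing `l x * l y` then takes the
  -- value `l z ^ 2 ≠ 0` at `(z, z)`.
  obtain ⟨l, hl⟩ := Module.Projective.exists_dual_ne_zero (ResidueField Q)
    (V := CotangentSpace Q) hne
  let g : Q → ResidueField Q := fun x =>
    if h : x ∈ maximalIdeal Q then l ((maximalIdeal Q).toCotangent ⟨x, h⟩) else 0
  have hg : ∀ x (h : x ∈ maximalIdeal Q), g x = l ((maximalIdeal Q).toCotangent ⟨x, h⟩) :=
    fun x h => dif_pos h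
  have hgmul : ∀ r, ∀ x ∈ maximalIdeal Q, g (r * x) = residue Q r * g x := fun r x hx => by
    rw [hg _ (Ideal.mul_mem_left _ _ hx), hg _ hx, ← smul_eq_mul (residue Q r), ← map_smul,
      ← ResidueField.algebraMap_eq, algebraMap_smul, ← map_smul]
    rfl
  refine .of_pairing (β := fun x y => g x * g y) ⟨?_, fun x _ y _ => mul_comm _ _, ?_⟩ hz hz0 hz ?_
  · intro x hx x' hx' y hy
    have : g (x + x') = g x + g x' := by
      rw [hg _ (add_mem hx hx'), hg _ hx, hg _ hx', ← map_add, ← map_add]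
      rfl
    simp only [this, add_mul]
  · intro r x hx y hy
    simp only [hgmul r x hx, hgmul r y hy]
    ring
  · simp only [hg z hz]
    exact mul_ne_zero hl hl

end

/-! ### Burch ideals and socle products -/

section presentation

variable {A Q : Type*} [CommRing A] [IsLocalRing A] [CommRing Q] [IsLocalRing Q]

lemma map_mem_maximalIdeal_iff_of_surjective {f : A →+* Q} (hf : Function.Surjective f) {a : A} :
    f a ∈ maximalIdeal Q ↔ a ∈ maximalIdeal A := by
  have := IsLocalHom.of_surjective f hf
  simp [mem_maximalIdeal, mem_nonunits_iff]

/-- If a quotient of a local ring by a Burch ideal is not a field, then its socle has a nonzero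
product with the maximal ideal inside the symmetric square. -/
lemma SocleSymmSqNeZero.of_isBurchIdeal {f : A →+* Q} (hf : Function.Surjective f)
    (hQ : ¬ IsField Q) (hI : IsBurchIdeal (RingHom.ker f)) : SocleSymmSqNeZero Q := by
  set I := RingHom.ker f with hIdef
  set n := maximalIdeal A with hn
  have hmem : ∀ {a}, f a ∈ maximalIdeal Q ↔ a ∈ n := map_mem_maximalIdeal_iff_of_surjective hf
  have hle : I ≤ I.colon (n : Set A) := fun x hx => Submodule.mem_colon.2 fun y _ =>
    I.mul_mem_right _ hx
  obtain ⟨z, hz, x, hx, hzx⟩ : ∃ z ∈ I.colon (n : Set A), ∃ x ∈ n, x * z ∉ n * I := by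
    by_contra! hcon
    exact hI (le_antisymm (Ideal.mul_mono_right hle) (Ideal.mul_le.2 fun x hx z hz => hcon z hz x hx))
  rw [Submodule.mem_colon] at hz
  -- If `z` were a unit, then `n ≤ I` and the quotient would be a field.
  have hzn : z ∈ n := by
    by_contra hzn
    have hu : IsUnit z := by simpa [hn] using hzn
    have hnI : n ≤ I := fun y hy => by
      have := hz y hy
      rw [smul_eq_mul] at this
      exact (Ideal.unit_mul_mem_iff_mem _ hu).1 this
    refine hQ (IsLocalRing.isField_iff_maximalIdeal_eq.2 ?_)
    rw [eq_bot_iff]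
    intro q hq
    obtain ⟨a, rfl⟩ := hf q
    exact hnI (hmem.1 hq)
  choose s hs using hf
  have hsn : ∀ q ∈ maximalIdeal Q, s q ∈ n := fun q hq => hmem.1 (by rwa [hs])
  have hk : ∀ {a b c : A}, f a = f b → c ∈ n →
      Ideal.Quotient.mk (n * I) (c * a) = Ideal.Quotient.mk (n * I) (c * b) := by
    intro a b c hab hc
    rw [Ideal.Quotient.eq, ← mul_sub]
    exact Ideal.mul_mem_mul hc (by rw [hIdef, RingHom.mem_ker, map_sub, hab, sub_self])
  have hk' : ∀ {a b c : A}, f a = f b → c ∈ n →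
      Ideal.Quotient.mk (n * I) (a * c) = Ideal.Quotient.mk (n * I) (b * c) := by
    intro a b c hab hc
    rw [mul_comm a, mul_comm b, hk hab hc]
  -- Multiply lifts and read the result modulo `n * I`: changing the lift of one factor by an
  -- element of `I` has no effect, since the other factor is in `n`.
  refine .of_pairing (β := fun x y => Ideal.Quotient.mk (n * I) (s x * s y))
    ⟨?_, fun x _ y _ => congrArg _ (mul_comm _ _), ?_⟩ (z := f z) (x := f x) (hmem.2 hzn) ?_ (hmem.2 hx) ?_
  · intro x hx x' hx' y hy
    rw [← map_add, ← add_mul]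
    exact hk' (by simp [hs]) (hsn y hy)
  · intro r x hx y hy
    have h1 := hk' (a := s (r * x)) (b := s r * s x) (c := s y) (by simp [hs]) (hsn y hy)
    have h2 := hk (a := s (r * y)) (b := s r * s y) (c := s x) (by simp [hs]) (hsn x hx)
    rw [h1, h2]
    congr 1
    ring
  · intro y hy
    obtain ⟨a, rfl⟩ : ∃ a, f a = y := ⟨s y, hs y⟩
    rw [← map_mul, mul_comm]
    exact hz a (hmem.1 hy)
  · have h1 := hk' (a := s (f z)) (b := z) (c := s (f x)) (hs _) (hsn _ (hmem.2 hx))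
    have h2 := hk (a := s (f x)) (b := x) (c := z) (hs _) hzn
    rw [Ne, h1, h2, Ideal.Quotient.eq_zero_iff_mem, mul_comm z]
    exact hzx

/-- The graph of the linear map induced by a symmetric pairing on products. -/
def pairingGraph {M : Type*} [AddCommGroup M] (β : A → A → M) (J : Ideal A) : AddSubgroup (A × M) :=
  AddSubgroup.closure {p | ∃ a ∈ maximalIdeal A, ∃ x ∈ J, p = (a * x, β a x)}

lemma fst_mem_of_mem_pairingGraph {M : Type*} [AddCommGroup M] {β : A → A → M} {J : Ideal A}
    {p : A × M} (hp : p ∈ pairingGraph β J) : p.1 ∈ J := by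
  induction hp using AddSubgroup.closure_induction with
  | mem p hp =>
    obtain ⟨a, -, x, hx, rfl⟩ := hp
    exact J.mul_mem_left _ hx
  | zero => exact zero_mem _
  | add p q _ _ hp hq => exact add_mem hp hq
  | neg p _ hp => exact neg_mem hp

/-- As `β a (y + c r) = β a y + β (c a) r`, all contributions of the new generator `r` gather into
one term. -/
lemma exists_of_mem_pairingGraph_sup {M : Type*} [AddCommGroup M] {β : A → A → M}
    (hβ : IsSymmPairing β) {J : Ideal A} {r : A} (hJ : J ≤ maximalIdeal A)
    (hr : r ∈ maximalIdeal A) {p : A × M} (hp : p ∈ pairingGraph β (J ⊔ Ideal.span {r})) :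
    ∃ a ∈ maximalIdeal A, ∃ q ∈ pairingGraph β J, p = q + (a * r, β a r) := by
  induction hp using AddSubgroup.closure_induction with
  | mem p hp =>
    obtain ⟨a, ha, x, hx, rfl⟩ := hp
    obtain ⟨y, hy, w, hw, rfl⟩ := Submodule.mem_sup.1 hx
    obtain ⟨c, rfl⟩ := Ideal.mem_span_singleton'.1 hw
    refine ⟨c * a, Ideal.mul_mem_left _ _ ha, (a * y, β a y),
      AddSubgroup.subset_closure ⟨a, ha, y, hy, rfl⟩, ?_⟩
    rw [hβ.add_right ha (hJ hy) (Ideal.mul_mem_left _ _ hr), hβ.mul_left c a ha r hr]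
    ext
    · simp only [Prod.fst_add]; ring
    · rfl
  | zero =>
    exact ⟨0, zero_mem _, 0, zero_mem _, by ext <;> simp [hβ.zero_left hr]⟩
  | add p q _ _ hp hq =>
    obtain ⟨a, ha, p', hp', rfl⟩ := hp
    obtain ⟨b, hb, q', hq', rfl⟩ := hq
    refine ⟨a + b, add_mem ha hb, p' + q', add_mem hp' hq', ?_⟩
    rw [hβ.add_left a ha b hb r hr]
    ext
    · simp only [Prod.fst_add]; ring
    · simp only [Prod.snd_add]; abel
  | neg p _ hp =>
    obtain ⟨a, ha, p', hp', rfl⟩ := hp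
    refine ⟨-a, neg_mem ha, -p', neg_mem hp', ?_⟩
    have : β (-a) r = - β a r := by
      rw [← zero_sub, hβ.sub_left (zero_mem _) ha hr, hβ.zero_left hr, zero_sub]
    rw [this]
    ext
    · simp only [Prod.fst_add, Prod.fst_neg]; ring
    · simp only [Prod.snd_add, Prod.snd_neg]; abel

/-- On an ideal generated by a regular sequence, a symmetric pairing factors through the
product. -/
lemma snd_eq_zero_of_mem_pairingGraph {M : Type*} [AddCommGroup M] {β : A → A → M}
    (hβ : IsSymmPairing β) {rs : List A} (hrs : RingTheory.Sequence.IsWeaklyRegular A rs)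
    (hm : ∀ r ∈ rs, r ∈ maximalIdeal A) {m : M}
    (h : ((0 : A), m) ∈ pairingGraph β (Ideal.ofList rs)) : m = 0 := by
  induction rs using List.reverseRecOn generalizing m with
  | nil =>
    rw [Ideal.ofList_nil] at h
    have : pairingGraph β (⊥ : Ideal A) = ⊥ := by
      rw [pairingGraph, AddSubgroup.closure_eq_bot_iff]
      rintro p ⟨a, ha, x, hx, rfl⟩
      rw [Ideal.mem_bot] at hx
      simp [hx, hβ.zero_right ha]
    rw [this] at h
    simpa using h
  | append_singleton rs r ih =>
    have hm' : ∀ x ∈ rs, x ∈ maximalIdeal A := fun x hx => hm x (by simp [hx])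
    have hr : r ∈ maximalIdeal A := hm r (by simp)
    have hJ : Ideal.ofList rs ≤ maximalIdeal A := Ideal.span_le.2 hm'
    rw [RingTheory.Sequence.isWeaklyRegular_append_iff,
      RingTheory.Sequence.isWeaklyRegular_singleton_iff] at hrs
    rw [Ideal.ofList_append, Ideal.ofList_singleton] at h
    obtain ⟨a, ha, q, hq, hpq⟩ := exists_of_mem_pairingGraph_sup hβ hJ hr h
    have h1 : a * r ∈ Ideal.ofList rs := by
      have := fst_mem_of_mem_pairingGraph hq
      have h2 : (0 : A) = q.1 + a * r := congrArg Prod.fst hpq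
      rw [eq_neg_of_add_eq_zero_right h2.symm]
      exact neg_mem this
    -- `r` is regular modulo the earlier elements. By symmetry `(a r, β a r)` can then be read as
    -- the generator `(r a, β r a)` over the smaller ideal, which removes `r`.
    have h3 : a ∈ Ideal.ofList rs := by
      have h4 : r • (Submodule.Quotient.mk a : A ⧸ (Ideal.ofList rs • ⊤ : Submodule A A)) =
          r • (0 : A ⧸ (Ideal.ofList rs • ⊤ : Submodule A A)) := by
        rw [smul_zero, ← Submodule.Quotient.mk_smul, Submodule.Quotient.mk_eq_zero]
        simpa [mul_comm] using h1
      have := hrs.2 h4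
      rw [Submodule.Quotient.mk_eq_zero] at this
      simpa using this
    refine ih hrs.1 hm' ?_
    rw [hpq]
    refine add_mem hq (AddSubgroup.subset_closure ⟨r, hr, a, h3, ?_⟩)
    rw [mul_comm, hβ.symm a ha r hr]

/-- If the maximal ideal of a local ring is generated by a regular sequence, then the kernel of any
surjection onto a ring whose socle is nonzero in the symmetric square is a Burch ideal. -/
lemma SocleSymmSqNeZero.isBurchIdeal {rs : List A}
    (hrs : RingTheory.Sequence.IsWeaklyRegular A rs) (hm : Ideal.ofList rs = maximalIdeal A)
    {f : A →+* Q} (hf : Function.Surjective f) (h : SocleSymmSqNeZero Q) :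
    IsBurchIdeal (RingHom.ker f) := by
  obtain ⟨z, hz, hz0, x, hx, hzx⟩ := h.exists_univPairing_ne_zero
  obtain ⟨z, rfl⟩ := hf z
  obtain ⟨x, rfl⟩ := hf x
  have hmem : ∀ {a}, f a ∈ maximalIdeal Q ↔ a ∈ maximalIdeal A :=
    map_mem_maximalIdeal_iff_of_surjective hf
  have hβ := isSymmPairing_univPairing.comp f fun a ha => hmem.2 ha
  rw [hmem] at hz hx
  intro heq
  have hcol : z ∈ (RingHom.ker f).colon (maximalIdeal A : Set A) :=
    Submodule.mem_colon.2 fun y hy => by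
      rw [smul_eq_mul, RingHom.mem_ker, map_mul, mul_comm]
      exact hz0 _ (hmem.2 hy)
  have h1 : x * z ∈ maximalIdeal A * RingHom.ker f := by
    rw [heq]; exact Ideal.mul_mem_mul hx hcol
  -- The pulled-back pairing vanishes on the kernel. So if `x * z` were in `n I`, both `(x z, β x
  -- z)` and `(x z, 0)` would lie in the graph, contradicting that it is a graph.
  have h2 : ∀ y ∈ maximalIdeal A * RingHom.ker f,
      (y, (0 : (maximalIdeal Q ⊗[Q] maximalIdeal Q) ⧸ symmRel Q)) ∈
        pairingGraph (fun a b => univPairing (f a) (f b)) (maximalIdeal A) := by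
    intro y hy
    induction hy using Submodule.mul_induction_on' with
    | mem_mul_mem a ha b hb =>
      have hb0 : f b = 0 := hb
      have hbm : b ∈ maximalIdeal A := hmem.1 (by rw [hb0]; exact zero_mem _)
      refine AddSubgroup.subset_closure ⟨a, ha, b, hbm, ?_⟩
      simp only [hb0, isSymmPairing_univPairing.zero_right (hmem.2 ha)]
    | add a _ b _ ha hb => simpa using add_mem ha hb
  have h3 : (x * z, univPairing (f x) (f z)) ∈
      pairingGraph (fun a b => univPairing (f a) (f b)) (maximalIdeal A) :=
    AddSubgroup.subset_closure ⟨x, hx, z, hz, rfl⟩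
  have h4 := sub_mem h3 (h2 _ h1)
  rw [Prod.mk_sub_mk, sub_self, sub_zero, ← hm] at h4
  have h5 := snd_eq_zero_of_mem_pairingGraph hβ hrs
    (fun r hr => by rw [← hm]; exact Ideal.subset_span hr) h4
  exact hzx (by rw [isSymmPairing_univPairing.symm _ (hmem.2 hz) _ (hmem.2 hx), h5])

end presentation

/-! ### Socle products in a fibre product -/

/-- A fibre product of local rings over the residue field, described by its two projections. -/
structure IsLocalFibre {R S T : Type*} [CommRing R] [IsLocalRing R] [CommRing S] [IsLocalRing S]
    [CommRing T] [IsLocalRing T] (p : R →+* S) (q : R →+* T) : Prop where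
  surj_left : Function.Surjective p
  surj_right : Function.Surjective q
  ext : ∀ x y, p x = p y → q x = q y → x = y
  lift_left : ∀ s ∈ maximalIdeal S, ∃ x, p x = s ∧ q x = 0
  lift_right : ∀ t ∈ maximalIdeal T, ∃ x, p x = 0 ∧ q x = t

namespace IsLocalFibre

variable {R S T : Type*} [CommRing R] [IsLocalRing R] [CommRing S] [IsLocalRing S]
  [CommRing T] [IsLocalRing T] {p : R →+* S} {q : R →+* T}

lemma swap (h : IsLocalFibre p q) : IsLocalFibre q p where
  surj_left := h.surj_right
  surj_right := h.surj_left
  ext x y hx hy := h.ext x y hy hx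
  lift_left t ht := (h.lift_right t ht).imp fun _ hx => ⟨hx.2, hx.1⟩
  lift_right t ht := (h.lift_left t ht).imp fun _ hx => ⟨hx.2, hx.1⟩

lemma mem_left_iff (h : IsLocalFibre p q) {x : R} :
    p x ∈ maximalIdeal S ↔ x ∈ maximalIdeal R :=
  map_mem_maximalIdeal_iff_of_surjective h.surj_left

lemma mem_right_iff (h : IsLocalFibre p q) {x : R} :
    q x ∈ maximalIdeal T ↔ x ∈ maximalIdeal R :=
  map_mem_maximalIdeal_iff_of_surjective h.surj_right

lemma socle_of_left (h : IsLocalFibre p q) {z : R} (hz : ∀ s ∈ maximalIdeal S, s * p z = 0)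
    (hz' : q z = 0) : ∀ y ∈ maximalIdeal R, y * z = 0 := fun y hy => h.ext _ _
  (by rw [map_mul, map_zero, hz _ (h.mem_left_iff.2 hy)]) (by rw [map_mul, hz', mul_zero, map_zero])

lemma socleSymmSqNeZero_of_left (h : IsLocalFibre p q) (hS : SocleSymmSqNeZero S) :
    SocleSymmSqNeZero R := by
  obtain ⟨z, hz, hz0, x, hx, hzx⟩ := hS.exists_univPairing_ne_zero
  obtain ⟨z', rfl, hz'⟩ := h.lift_left z hz
  obtain ⟨x', rfl, hx'⟩ := h.lift_left x hx
  exact .of_pairing (isSymmPairing_univPairing.comp p fun x hx => h.mem_left_iff.2 hx)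
    (h.mem_left_iff.1 hz) (h.socle_of_left hz0 hz') (h.mem_left_iff.1 hx) hzx

/-- If `p z` is outside the square of the maximal ideal, it suffices by itself. Otherwise `z` pairs
to zero with the `T`-component of `x`, so restricting `β` along `s ↦ (s, 0)` loses nothing. -/
lemma socleSymmSqNeZero_left (h : IsLocalFibre p q) {M : Type*} [AddCommGroup M] {β : R → R → M}
    (hβ : IsSymmPairing β) {z x : R} (hz : z ∈ maximalIdeal R)
    (hz0 : ∀ y ∈ maximalIdeal R, y * z = 0) (hqz : q z = 0) (hx : x ∈ maximalIdeal R)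
    (hzx : β z x ≠ 0) : SocleSymmSqNeZero S := by
  classical
  have hpz0 : ∀ s ∈ maximalIdeal S, s * p z = 0 := by
    intro s hs
    obtain ⟨y, rfl⟩ := h.surj_left s
    rw [← map_mul, hz0 y (h.mem_left_iff.1 hs), map_zero]
  by_cases hsq : p z ∈ maximalIdeal S ^ 2
  swap
  · exact .of_notMem_sq (h.mem_left_iff.2 hz) hpz0 hsq
  have : ∀ s : S, ∃ y : R, s ∈ maximalIdeal S → p y = s ∧ q y = 0 := fun s => by
    by_cases hs : s ∈ maximalIdeal S
    · obtain ⟨y, hy⟩ := h.lift_left s hs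
      exact ⟨y, fun _ => hy⟩
    · exact ⟨0, fun h => absurd h hs⟩
  choose i hi using this
  have him : ∀ s ∈ maximalIdeal S, i s ∈ maximalIdeal R := fun s hs =>
    h.mem_left_iff.1 (by rwa [(hi s hs).1])
  obtain ⟨x2, hx2p, hx2q⟩ := h.lift_right (q x) (h.mem_right_iff.2 hx)
  have hx2 : x2 ∈ maximalIdeal R := h.mem_left_iff.1 (by rw [hx2p]; exact zero_mem _)
  have hix := hi _ (h.mem_left_iff.2 hx)
  have hiz := hi _ (h.mem_left_iff.2 hz)
  have hx12 : x = i (p x) + x2 := h.ext _ _ (by rw [map_add, hix.1, hx2p, add_zero])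
    (by rw [map_add, hix.2, hx2q, zero_add])
  have hz1 : i (p z) = z := h.ext _ _ hiz.1 (by rw [hiz.2, hqz])
  -- Mixed products die on the square: `β (ab, t) = β (b, a t)`, and `a t = 0`.
  have h0 : ∀ s ∈ maximalIdeal S ^ 2, s ∈ maximalIdeal S ∧ β (i s) x2 = 0 := by
    intro s hs
    rw [pow_two] at hs
    induction hs using Submodule.mul_induction_on' with
    | mem_mul_mem a ha b hb =>
      have hab : a * b ∈ maximalIdeal S := Ideal.mul_mem_left _ _ hb
      refine ⟨hab, ?_⟩
      have e1 : i (a * b) = i a * i b := h.ext _ _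
        (by rw [map_mul, (hi _ hab).1, (hi _ ha).1, (hi _ hb).1])
        (by rw [map_mul, (hi _ hab).2, (hi _ ha).2, zero_mul])
      have e2 : i a * x2 = 0 := h.ext _ _ (by rw [map_mul, hx2p, mul_zero, map_zero])
        (by rw [map_mul, (hi _ ha).2, zero_mul, map_zero])
      rw [e1, hβ.mul_left _ _ (him b hb) _ hx2, e2, hβ.zero_right (him b hb)]
    | add a _ b _ ha hb =>
      have hab := add_mem ha.1 hb.1
      refine ⟨hab, ?_⟩
      have e1 : i (a + b) = i a + i b := h.ext _ _
        (by rw [map_add, (hi _ hab).1, (hi _ ha.1).1, (hi _ hb.1).1])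
        (by rw [map_add, (hi _ hab).2, (hi _ ha.1).2, (hi _ hb.1).2, add_zero])
      rw [e1, hβ.add_left _ (him _ ha.1) _ (him _ hb.1) _ hx2, ha.2, hb.2, add_zero]
  refine .of_pairing (β := fun s s' => β (i s) (i s'))
    ⟨?_, fun s hs s' hs' => hβ.symm _ (him s hs) _ (him s' hs'), ?_⟩
    (h.mem_left_iff.2 hz) hpz0 (h.mem_left_iff.2 hx) ?_
  · intro a ha b hb c hc
    have hab := add_mem ha hb
    have e1 : i (a + b) = i a + i b := h.ext _ _
      (by rw [map_add, (hi _ hab).1, (hi _ ha).1, (hi _ hb).1])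
      (by rw [map_add, (hi _ hab).2, (hi _ ha).2, (hi _ hb).2, add_zero])
    rw [e1, hβ.add_left _ (him _ ha) _ (him _ hb) _ (him _ hc)]
  · intro r a ha b hb
    obtain ⟨r, rfl⟩ := h.surj_left r
    have e : ∀ a ∈ maximalIdeal S, i (p r * a) = r * i a := fun a ha => h.ext _ _
      (by rw [map_mul, (hi _ (Ideal.mul_mem_left _ _ ha)).1, (hi _ ha).1])
      (by rw [map_mul, (hi _ (Ideal.mul_mem_left _ _ ha)).2, (hi _ ha).2, mul_zero])
    rw [e a ha, e b hb, hβ.mul_left _ _ (him _ ha) _ (him _ hb)]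
  · have h2 := (h0 _ hsq).2
    rw [hz1] at h2
    rw [hx12, hβ.add_right hz (him _ (h.mem_left_iff.2 hx)) hx2, h2, add_zero] at hzx
    rwa [hz1]

/-- Both components of a socle element are again socle elements, and one of them has a nonzero
product with `x`. -/
lemma socleSymmSqNeZero_iff (h : IsLocalFibre p q) :
    SocleSymmSqNeZero R ↔ SocleSymmSqNeZero S ∨ SocleSymmSqNeZero T := by
  refine ⟨fun hR => ?_, fun hST => hST.elim h.socleSymmSqNeZero_of_left
    h.swap.socleSymmSqNeZero_of_left⟩
  obtain ⟨z, hz, hz0, x, hx, hzx⟩ := hR.exists_univPairing_ne_zero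
  obtain ⟨z1, hz1p, hz1q⟩ := h.lift_left _ (h.mem_left_iff.2 hz)
  obtain ⟨z2, hz2p, hz2q⟩ := h.lift_right _ (h.mem_right_iff.2 hz)
  have hz12 : z = z1 + z2 := h.ext _ _ (by rw [map_add, hz1p, hz2p, add_zero])
    (by rw [map_add, hz1q, hz2q, zero_add])
  have hz1 : z1 ∈ maximalIdeal R := h.mem_left_iff.1 (by rw [hz1p]; exact h.mem_left_iff.2 hz)
  have hz2 : z2 ∈ maximalIdeal R := h.mem_right_iff.1 (by rw [hz2q]; exact h.mem_right_iff.2 hz)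
  have hz10 : ∀ y ∈ maximalIdeal R, y * z1 = 0 := fun y hy => h.ext _ _
    (by rw [map_mul, hz1p, ← map_mul, hz0 y hy]) (by rw [map_mul, hz1q, mul_zero, map_zero])
  have hz20 : ∀ y ∈ maximalIdeal R, y * z2 = 0 := fun y hy => h.ext _ _
    (by rw [map_mul, hz2p, mul_zero, map_zero]) (by rw [map_mul, hz2q, ← map_mul, hz0 y hy])
  rw [hz12, isSymmPairing_univPairing.add_left _ hz1 _ hz2 _ hx] at hzx
  by_cases h1 : univPairing z1 x = 0
  · rw [h1, zero_add] at hzx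
    exact .inr (h.swap.socleSymmSqNeZero_left isSymmPairing_univPairing hz2 hz20 hz2p hx hzx)
  · exact .inl (h.socleSymmSqNeZero_left isSymmPairing_univPairing hz1 hz10 hz1q hx h1)

end IsLocalFibre

end Burch

/-! ### Power series rings and regular presentations -/

namespace Burch

open IsLocalRing

/-- The maximal ideal of a local ring is generated by a (weakly) regular sequence. -/
def HasRegularParameters (A : Type*) [CommRing A] [IsLocalRing A] : Prop :=
  ∃ rs : List A, RingTheory.Sequence.IsWeaklyRegular A rs ∧ Ideal.ofList rs = maximalIdeal A

section powerSeries

open PowerSeries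

variable {A : Type*} [CommRing A]

instance isLocalRing_powerSeries [IsLocalRing A] : IsLocalRing A⟦X⟧ :=
  inferInstanceAs (IsLocalRing (MvPowerSeries Unit A))

lemma powerSeries_mem_maximalIdeal_iff [IsLocalRing A] {f : A⟦X⟧} :
    f ∈ maximalIdeal A⟦X⟧ ↔ constantCoeff f ∈ maximalIdeal A := by
  rw [mem_maximalIdeal, mem_maximalIdeal, mem_nonunits_iff, mem_nonunits_iff,
    PowerSeries.isUnit_iff_constantCoeff]

lemma map_constantCoeff_maximalIdeal [IsLocalRing A] :
    (maximalIdeal A⟦X⟧).map (constantCoeff (R := A)) = maximalIdeal A := by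
  refine le_antisymm (Ideal.map_le_iff_le_comap.2 fun f hf =>
    powerSeries_mem_maximalIdeal_iff.1 hf) fun a ha => ?_
  have : C a ∈ maximalIdeal A⟦X⟧ := powerSeries_mem_maximalIdeal_iff.2 (by simpa using ha)
  simpa using Ideal.mem_map_of_mem constantCoeff this

/-- Adjoining `X` adds at most one generator to the maximal ideal and at least one to the dimension.
-/
instance isRegularLocalRing_powerSeries [IsRegularLocalRing A] : IsRegularLocalRing A⟦X⟧ := by
  refine IsRegularLocalRing.of_spanFinrank_maximalIdeal_le _ ?_
  have h1 := PowerSeries.spanFinrank_le_spanFinrank_map_constantCoeff_add_one_of_X_mem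
    (I := maximalIdeal A⟦X⟧) (powerSeries_mem_maximalIdeal_iff.2 (by simp))
  rw [map_constantCoeff_maximalIdeal] at h1
  refine le_trans ?_ ringKrullDim_succ_le_ringKrullDim_powerseries
  rw [← IsRegularLocalRing.spanFinrank_maximalIdeal (R := A)]
  exact_mod_cast h1

/-- Power series modulo `X`, as an additive group. -/
noncomputable def quotXEquiv : QuotSMulTop (X : A⟦X⟧) A⟦X⟧ ≃+ A :=
  (QuotientAddGroup.quotientAddEquivOfEq (by
    ext f
    simp only [Submodule.mem_toAddSubgroup, AddMonoidHom.mem_ker,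
      RingHom.toAddMonoidHom_eq_coe, AddMonoidHom.coe_coe, ← PowerSeries.X_dvd_iff]
    rw [Submodule.mem_smul_pointwise_iff_exists]
    exact ⟨fun ⟨g, _, h⟩ => ⟨g, h.symm⟩, fun ⟨g, h⟩ => ⟨g, trivial, h.symm⟩⟩)).trans
  (QuotientAddGroup.quotientKerEquivOfSurjective
    ((constantCoeff (R := A)).toAddMonoidHom) (fun a => ⟨C a, by simp⟩))

lemma quotXEquiv_mk (f : A⟦X⟧) : quotXEquiv (Submodule.Quotient.mk f) = constantCoeff f := rfl

lemma HasRegularParameters.powerSeries [IsLocalRing A] (h : HasRegularParameters A) :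
    HasRegularParameters A⟦X⟧ := by
  obtain ⟨rs, hrs, hm⟩ := h
  refine ⟨X :: rs.map C, ?_, ?_⟩
  · rw [RingTheory.Sequence.isWeaklyRegular_cons_iff]
    refine ⟨fun f g hfg => ?_, ?_⟩
    · exact PowerSeries.X_mul_cancel hfg
    · refine (AddEquiv.isWeaklyRegular_congr (e := quotXEquiv) (bs := rs) ?_).2 hrs
      rw [List.forall₂_map_left_iff, List.forall₂_same]
      intro r _ x
      obtain ⟨f, rfl⟩ := Submodule.Quotient.mk_surjective _ x
      rw [← Submodule.Quotient.mk_smul, quotXEquiv_mk, quotXEquiv_mk]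
      simp
  · rw [Ideal.ofList_cons, ← Ideal.map_ofList, hm]
    refine le_antisymm (sup_le ?_ ?_) fun f hf => ?_
    · rw [Ideal.span_singleton_le_iff_mem, powerSeries_mem_maximalIdeal_iff]
      simp
    · refine Ideal.map_le_iff_le_comap.2 fun a ha => ?_
      rw [Ideal.mem_comap, powerSeries_mem_maximalIdeal_iff]
      simpa using ha
    · rw [f.eq_X_mul_shift_add_const]
      exact Submodule.add_mem_sup (Ideal.mul_mem_right _ _ (Ideal.mem_span_singleton_self _))
        (Ideal.mem_map_of_mem _ (powerSeries_mem_maximalIdeal_iff.1 hf))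

lemma HasRegularParameters.of_ringEquiv {B : Type*} [CommRing B] [IsLocalRing A] [IsLocalRing B]
    (e : A ≃+* B) (h : HasRegularParameters A) : HasRegularParameters B := by
  obtain ⟨rs, hrs, hm⟩ := h
  refine ⟨rs.map e, ?_, ?_⟩
  · refine (AddEquiv.isWeaklyRegular_congr (e := e.toAddEquiv) ?_).1 hrs
    rw [List.forall₂_map_right_iff, List.forall₂_same]
    intro r _ x
    simp
  · have := Ideal.map_ofList (e : A →+* B) rs
    rw [hm] at this
    rw [← map_ringEquiv_maximalIdeal e]
    exact this.symm

lemma hasRegularParameters_of_isPrincipal [IsDomain A] [IsLocalRing A]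
    (h : ∃ a, maximalIdeal A = Ideal.span {a}) : HasRegularParameters A := by
  obtain ⟨a, ha⟩ := h
  by_cases h0 : a = 0
  · exact ⟨[], .nil _ _, by simp [ha, h0]⟩
  · refine ⟨[a], ?_, by rw [ha, Ideal.ofList_singleton]⟩
    rw [RingTheory.Sequence.isWeaklyRegular_singleton_iff]
    intro x y hxy
    exact mul_left_cancel₀ h0 hxy

lemma mvPowerSeries_regular (D : Type*) [CommRing D] [IsRegularLocalRing D]
    (h : HasRegularParameters D) (n : ℕ) :
    IsRegularLocalRing (MvPowerSeries (Fin n) D) ∧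
      HasRegularParameters (MvPowerSeries (Fin n) D) := by
  induction n with
  | zero =>
    exact ⟨.of_ringEquiv (MvPowerSeries.isEmptyEquiv (Fin 0) D).toRingEquiv.symm,
      h.of_ringEquiv (MvPowerSeries.isEmptyEquiv (Fin 0) D).toRingEquiv.symm⟩
  | succ n ih =>
    have := ih.1
    exact ⟨.of_ringEquiv (MvPowerSeries.finSuccEquiv D n).toRingEquiv.symm,
      ih.2.powerSeries.of_ringEquiv (MvPowerSeries.finSuccEquiv D n).toRingEquiv.symm⟩

end powerSeries

/-- Evaluation of power series at elements of an ideal for which the target is complete. -/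
lemma exists_mvPowerSeries_eval {D Q : Type*} [CommRing D] [CommRing Q] (I : Ideal Q)
    [IsAdicComplete I Q] (g : D →+* Q) {n : ℕ} (x : Fin n → Q) (hx : ∀ i, x i ∈ I) :
    ∃ f : MvPowerSeries (Fin n) D →+* Q,
      (∀ d, f (MvPowerSeries.C d) = g d) ∧ ∀ i, f (MvPowerSeries.X i) = x i := by
  let e : MvPolynomial (Fin n) D →+* Q := MvPolynomial.eval₂Hom g x
  have he : ∀ k, MvPolynomial.idealOfVars (Fin n) D ^ k ≤ (I ^ k).comap e := by
    intro k
    rw [← Ideal.map_le_iff_le_comap, Ideal.map_pow]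
    refine Ideal.pow_right_mono ?_ k
    rw [MvPolynomial.idealOfVars, Ideal.map_span, Ideal.span_le]
    rintro _ ⟨_, ⟨i, rfl⟩, rfl⟩
    simpa [e] using hx i
  -- Truncate in total degree `k` and evaluate the polynomial modulo `I ^ k`; these maps are
  -- compatible and glue by completeness.
  let F : (k : ℕ) → MvPowerSeries (Fin n) D →+* Q ⧸ I ^ k := fun k =>
    (Ideal.quotientMap (I ^ k) e (he k)).comp
      (MvPowerSeries.truncTotalAlgHom (Fin n) D k : MvPowerSeries (Fin n) D →+* _)
  have hF : ∀ {k l : ℕ} (hle : k ≤ l), (Ideal.Quotient.factorPow I hle).comp (F l) = F k := by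
    intro k l hle
    ext p
    simp only [F, RingHom.comp_apply, RingHom.coe_coe, MvPowerSeries.truncTotalAlgHom_apply,
      Ideal.quotientMap_mk, Ideal.Quotient.factor_mk]
    rw [Ideal.Quotient.eq, ← map_sub]
    exact he k (MvPowerSeries.truncTotal_sub_truncTotal_mem_pow_idealOfVars hle le_rfl p)
  have hpoly : ∀ p : MvPolynomial (Fin n) D, IsAdicComplete.liftRingHom I F hF p = e p := by
    intro p
    have : IsHausdorff I Q := inferInstance
    rw [IsHausdorff.eq_iff_smodEq (I := I)]
    intro k
    rw [SModEq, smul_eq_mul, Ideal.mul_top]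
    change Ideal.Quotient.mk (I ^ k) _ = Ideal.Quotient.mk (I ^ k) _
    rw [IsAdicComplete.mk_liftRingHom]
    have := (MvPowerSeries.truncTotalAlgHom (Fin n) D k).commutes p
    simp only [F, RingHom.comp_apply, RingHom.coe_coe]
    change Ideal.quotientMap (I ^ k) e (he k) (MvPowerSeries.truncTotalAlgHom (Fin n) D k
      (algebraMap (MvPolynomial (Fin n) D) (MvPowerSeries (Fin n) D) p)) = _
    rw [this]
    exact Ideal.quotientMap_mk
  refine ⟨IsAdicComplete.liftRingHom I F hF, fun d => ?_, fun i => ?_⟩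
  · rw [← MvPolynomial.coe_C, hpoly]
    simp [e]
  · rw [← MvPolynomial.coe_X, hpoly]
    simp [e]

/-- A complete local ring with finitely generated maximal ideal receiving a map from a regular
local ring which is surjective on residue fields is a quotient of a regular local ring. -/
lemma exists_regular_presentation {D Q : Type u} [CommRing D] [IsRegularLocalRing D]
    (hD : HasRegularParameters D) [CommRing Q] [IsLocalRing Q] [IsAdicComplete (maximalIdeal Q) Q]
    (hfg : (maximalIdeal Q).FG) (g : D →+* Q)
    (hg : Function.Surjective ((residue Q).comp g)) :
    ∃ (A : Type u) (_ : CommRing A) (_ : IsRegularLocalRing A) (f : A →+* Q),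
      HasRegularParameters A ∧ Function.Surjective f := by
  obtain ⟨n, x, hx⟩ := Submodule.fg_iff_exists_fin_generating_family.1 hfg
  have hx' : ∀ i, x i ∈ maximalIdeal Q := fun i => by
    rw [← hx]; exact Submodule.subset_span ⟨i, rfl⟩
  obtain ⟨f, hfC, hfX⟩ := exists_mvPowerSeries_eval (maximalIdeal Q) g x hx'
  obtain ⟨h1, h2⟩ := mvPowerSeries_regular D hD n
  refine ⟨_, _, h1, f, h2, ?_⟩
  have hmap : (Ideal.span (Set.range MvPowerSeries.X) : Ideal (MvPowerSeries (Fin n) D)).map f =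
      maximalIdeal Q := by
    rw [Ideal.map_span, ← Set.range_comp]
    refine Eq.trans ?_ hx
    congr 1
    congr 1
    ext i
    exact hfX i
  have : IsHausdorff ((Ideal.span (Set.range MvPowerSeries.X) :
      Ideal (MvPowerSeries (Fin n) D)).map f) Q := by
    rw [hmap]; infer_instance
  -- The variables map onto generators of the maximal ideal, so surjectivity need only be checked
  -- modulo it, where `D` already suffices.
  refine surjective_of_mk_map_comp_surjective
    (I := (Ideal.span (Set.range MvPowerSeries.X) : Ideal (MvPowerSeries (Fin n) D))) f ?_
  intro q
  obtain ⟨q, rfl⟩ := Ideal.Quotient.mk_surjective q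
  obtain ⟨d, hd⟩ := hg (residue Q q)
  refine ⟨MvPowerSeries.C d, ?_⟩
  rw [RingHom.comp_apply, hfC, Ideal.Quotient.eq, hmap]
  exact (Ideal.Quotient.eq (I := maximalIdeal Q)).1 hd

end Burch

/-! ### Existence of p-bases -/

namespace Burch

section pBasis

open MvPolynomial

variable (k : Type*) [Field k] (p : ℕ) [Fact p.Prime] [CharP k p]

/-- The ideal of relations `X b ^ (p ^ n) = b` for `b` in a subset of a field. -/
noncomputable def rootIdeal {k : Type*} [Field k] (p : ℕ) (B : Set k) (n : ℕ) :
    Ideal (MvPolynomial B k) :=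
  Ideal.span (Set.range fun b : B => X b ^ p ^ n - C (b : k))

variable {k}

/-- The ring homomorphism to `k[X]/(X b ^ (p ^ n) = b)` inverting the Frobenius on `k`. -/
def HasRootHom (B : Set k) (n : ℕ) : Prop :=
  ∃ ψ : k →+* MvPolynomial B k ⧸ rootIdeal p B n,
    (∀ c, ψ (c ^ p ^ n) = Ideal.Quotient.mk _ (C c)) ∧ ∀ b : B, ψ b = Ideal.Quotient.mk _ (X b)

omit [Fact p.Prime] [CharP k p] in
lemma mk_X_pow (B : Set k) (n : ℕ) (b : B) :
    (Ideal.Quotient.mk (rootIdeal p B n) (X b)) ^ p ^ n =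
      Ideal.Quotient.mk (rootIdeal p B n) (C (b : k)) := by
  rw [← map_pow, Ideal.Quotient.eq]
  exact Ideal.subset_span ⟨b, rfl⟩

omit [Fact p.Prime] [CharP k p] in
-- Roots are extracted successively: apply the level-one map, then the level-`n` map to its
-- coefficients, where `X b` at level `n` is identified with `X b ^ p` at level `n + 1` by `expand`.
lemma HasRootHom.all {B : Set k} (h : HasRootHom p B 1) (n : ℕ) : HasRootHom p B n := by
  induction n with
  | zero =>
    refine ⟨(Ideal.Quotient.mk _).comp C, fun c => by simp, fun b => ?_⟩
    have := mk_X_pow p B 0 b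
    simpa using this.symm
  | succ n ih =>
    obtain ⟨ψ, hψ, hψ'⟩ := h
    obtain ⟨ψn, hn, hn'⟩ := ih
    let ex : MvPolynomial B k ⧸ rootIdeal p B n →+* MvPolynomial B k ⧸ rootIdeal p B (n + 1) :=
      Ideal.quotientMap _ (expand p : MvPolynomial B k →ₐ[k] MvPolynomial B k).toRingHom (by
        rw [rootIdeal, Ideal.span_le]
        rintro _ ⟨b, rfl⟩
        refine Ideal.subset_span ⟨b, ?_⟩
        simp [pow_succ', pow_mul])
    let χ : MvPolynomial B k ⧸ rootIdeal p B 1 →+* MvPolynomial B k ⧸ rootIdeal p B (n + 1) :=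
      Ideal.Quotient.lift _ (eval₂Hom (ex.comp ψn) fun b => Ideal.Quotient.mk _ (X b)) (by
        intro a ha
        rw [← RingHom.mem_ker]
        refine (Ideal.span_le.2 ?_) ha
        rintro _ ⟨b, rfl⟩
        rw [SetLike.mem_coe, RingHom.mem_ker]
        simp [hn', ex])
    refine ⟨χ.comp ψ, fun c => ?_, fun b => ?_⟩
    · have : c ^ p ^ (n + 1) = (c ^ p ^ n) ^ p ^ 1 := by rw [← pow_mul, pow_one, pow_succ]
      have h2 : χ (Ideal.Quotient.mk _ (C (c ^ p ^ n))) = ex (ψn (c ^ p ^ n)) := by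
        simp only [χ, Ideal.Quotient.lift_mk, coe_eval₂Hom, eval₂_C, RingHom.comp_apply]
      rw [RingHom.comp_apply, this, hψ, h2, hn]
      simp [ex]
    · rw [RingHom.comp_apply, hψ']
      simp [χ]

/-- Powers `1, a, …, a ^ (p - 1)` of a `p`-th root outside a subfield are linearly independent. -/
lemma eq_zero_of_aeval_eq_zero_of_degree_lt (L : Subfield k) {a : k} (ha : a ∉ L)
    (hap : a ^ p ∈ L) {P : Polynomial L} (hP : P.degree < p) (h0 : Polynomial.aeval a P = 0) :
    P = 0 := by
  have hp : p.Prime := Fact.out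
  have hirr : Irreducible (Polynomial.X ^ p - Polynomial.C (⟨a ^ p, hap⟩ : L)) := by
    refine X_pow_sub_C_irreducible_of_prime hp fun b hb => ha ?_
    have h1 : (b : k) ^ p = a ^ p := by simpa using congrArg (fun x : L => (x : k)) hb
    have : (b : k) = a := frobenius_inj k p h1
    rw [← this]
    exact b.2
  have hmin : minpoly L a = Polynomial.X ^ p - Polynomial.C (⟨a ^ p, hap⟩ : L) := by
    refine (minpoly.eq_of_irreducible_of_monic hirr ?_
      (Polynomial.monic_X_pow_sub_C _ hp.ne_zero)).symm
    simp [Algebra.algebraMap_eq_smul_one, Subfield.smul_def]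
  by_contra hne
  have := minpoly.degree_le_of_ne_zero L a hne h0
  rw [hmin, Polynomial.degree_X_pow_sub_C hp.pos] at this
  exact absurd hP (not_lt.2 this)

variable (k) in
/-- Every field of characteristic `p` has a `p`-basis. -/
theorem exists_pBasis : ∃ B : Set k,
    Subring.closure (Set.range (fun c : k => c ^ p) ∪ B) = ⊤ ∧ HasRootHom p B 1 := by
  classical
  have hp : p.Prime := Fact.out
  let : LinearOrder k := linearOrderOfSTO WellOrderingRel
  have wf : WellFounded (fun a b : k => a < b) := WellOrderingRel.isWellOrder.wf
  let cl : Set k → Subring k := fun S => Subring.closure (Set.range (fun c : k => c ^ p) ∪ S)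
  -- Greedy choice along a well-order: keep `b` when the p-th powers and the smaller elements do not
  -- generate it.
  let B : Set k := {b | b ∉ cl (Set.Iio b)}
  have hgen : cl B = ⊤ := by
    rw [eq_top_iff]
    rintro c -
    induction c using wf.induction with
    | _ c ih =>
      by_cases hc : c ∈ B
      · exact Subring.subset_closure (.inr hc)
      · have : c ∈ cl (Set.Iio c) := by simpa [B] using hc
        refine (Subring.closure_le.2 ?_) this
        rintro x (hx | hx)
        · exact Subring.subset_closure (.inl hx)
        · exact ih x hx
  refine ⟨B, hgen, ?_⟩
  set J := rootIdeal p B 1 with hJ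
  let x : B → MvPolynomial B k ⧸ J := fun b => Ideal.Quotient.mk J (X b)
  have hx : ∀ b : B, x b ^ p = algebraMap k _ (b : k) := fun b => by
    have := mk_X_pow p B 1 b
    rw [pow_one] at this
    exact this
  -- Frobenius on constants and `X b ↦ b`. Once `φ` is shown to be bijective, its inverse is the
  -- required root homomorphism.
  let φ : MvPolynomial B k ⧸ J →+* k :=
    Ideal.Quotient.lift J (eval₂Hom (frobenius k p) fun b : B => (b : k)) (by
      intro a ha
      rw [← RingHom.mem_ker]
      refine (Ideal.span_le.2 ?_) ha
      rintro _ ⟨b, rfl⟩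
      rw [SetLike.mem_coe, RingHom.mem_ker]
      simp [frobenius_def])
  have hφC : ∀ c : k, φ (algebraMap k _ c) = c ^ p := fun c => by
    change φ (Ideal.Quotient.mk J (C c)) = _
    simp [φ, frobenius_def]
  have hφx : ∀ b : B, φ (x b) = b := fun b => by simp [φ, x]
  have hinj : ∀ s : Finset B, ∀ q ∈ Algebra.adjoin k (x '' (s : Set B)), φ q = 0 → q = 0 := by
    intro s
    induction s using Finset.induction_on_max with
    | empty =>
      intro q hq h
      simp only [Finset.coe_empty, Set.image_empty, Algebra.adjoin_empty, Algebra.mem_bot] at hq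
      obtain ⟨c, rfl⟩ := hq
      rw [hφC] at h
      rw [pow_eq_zero_iff hp.ne_zero] at h
      rw [h, map_zero]
    | insert a s has ih =>
      intro q hq h
      set K := Algebra.adjoin k (x '' (s : Set B)) with hK
      have hLmem : ∀ q ∈ K, φ q ∈ cl (Set.Iio (a : k)) := by
        intro q hq
        induction hq using Algebra.adjoin_induction with
        | mem q hq =>
          obtain ⟨b, hb, rfl⟩ := hq
          rw [hφx]
          exact Subring.subset_closure (.inr (has b hb))
        | algebraMap c =>
          rw [hφC]
          exact Subring.subset_closure (.inl ⟨c, rfl⟩)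
        | add q r _ _ hq hr => rw [map_add]; exact add_mem hq hr
        | mul q r _ _ hq hr => rw [map_mul]; exact mul_mem hq hr
      -- The image of `K` is a field because p-th powers come from constants: `u⁻¹ = u ^ (p - 1) *
      -- (u⁻¹) ^ p`.
      let L : Subfield k :=
        { K.toSubring.map φ with
          inv_mem' := by
            rintro _ ⟨q, hq, rfl⟩
            by_cases h0 : φ q = 0
            · rw [h0, inv_zero]
              exact (K.toSubring.map φ).zero_mem
            · refine ⟨q ^ (p - 1) * algebraMap k _ (φ q)⁻¹,
                mul_mem (pow_mem hq _) (K.algebraMap_mem _), ?_⟩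
              rw [map_mul, map_pow, hφC, inv_pow]
              rw [← div_eq_mul_inv, div_eq_iff (pow_ne_zero _ h0), ← div_eq_inv_mul,
                eq_div_iff h0, ← pow_succ, Nat.sub_add_cancel hp.one_le] }
      have haL : (a : k) ∉ L := by
        rintro ⟨q, hq, hqa⟩
        exact a.2 (hqa ▸ hLmem q hq)
      have hapL : (a : k) ^ p ∈ L := ⟨algebraMap k _ (a : k), K.algebraMap_mem _, hφC _⟩
      rw [Finset.coe_insert, Set.image_insert_eq, Set.insert_eq, Set.union_comm,
        Algebra.adjoin_union_eq_adjoin_adjoin] at hq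
      replace hq : q ∈ Algebra.adjoin K {x a} := hq
      rw [Algebra.adjoin_singleton_eq_range_aeval] at hq
      obtain ⟨P, rfl⟩ := hq
      have hK0 : Nontrivial K := (φ.comp K.subtype).domain_nontrivial
      -- Reduction modulo `m` makes the degree less than `p`. As `a` is larger than all of `s`, it
      -- is not in `L`, so the coefficients map to zero in `L` and vanish by induction.
      let m : Polynomial K := Polynomial.X ^ p - Polynomial.C (algebraMap k K (a : k))
      have hm : m.Monic := Polynomial.monic_X_pow_sub_C _ hp.ne_zero
      have hma : Polynomial.aeval (x a) m = 0 := by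
        simp only [m, map_sub, map_pow, Polynomial.aeval_X, Polynomial.aeval_C, hx]
        exact sub_self _
      have hPmod : Polynomial.aeval (x a) (P %ₘ m) = Polynomial.aeval (x a) P := by
        conv_rhs => rw [← Polynomial.modByMonic_add_div P m]
        rw [map_add, map_mul, hma, zero_mul, add_zero]
      change φ (Polynomial.aeval (x a) P) = 0 at h
      change Polynomial.aeval (x a) P = 0
      rw [← hPmod] at h ⊢
      set P' := P %ₘ m
      have hdeg : P'.degree < p := by
        have h1 := Polynomial.degree_modByMonic_lt P hm
        rwa [Polynomial.degree_X_pow_sub_C hp.pos] at h1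
      let φK : K →+* L := (φ.comp K.subtype).codRestrict L fun q => ⟨q, q.2, rfl⟩
      have h1 : Polynomial.aeval (a : k) (P'.map φK) = 0 := by
        rw [← h, Polynomial.aeval_def, Polynomial.eval₂_map, Polynomial.aeval_def,
          Polynomial.hom_eval₂, hφx]
        rfl
      have h2 := eq_zero_of_aeval_eq_zero_of_degree_lt p L haL hapL
        (lt_of_le_of_lt Polynomial.degree_map_le hdeg) h1
      have h3 : P' = 0 := by
        ext1 i
        have h4 := congrArg (fun R => ((Polynomial.coeff R i : L) : k)) h2
        simp only [Polynomial.coeff_map, Polynomial.coeff_zero] at h4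
        exact Subtype.ext (ih _ (P'.coeff i).2 h4)
      rw [h3, map_zero]
  have hbij : Function.Bijective φ := by
    refine ⟨(injective_iff_map_eq_zero φ).2 fun q hq => ?_, fun c => ?_⟩
    · obtain ⟨P, rfl⟩ := Ideal.Quotient.mk_surjective q
      refine hinj P.vars _ ?_ hq
      have h1 : P ∈ MvPolynomial.supported k (P.vars : Set B) :=
        MvPolynomial.mem_supported.2 subset_rfl
      rw [MvPolynomial.supported] at h1
      have h2 : Ideal.Quotient.mkₐ k J P ∈ (Algebra.adjoin k (X '' (P.vars : Set B))).map
          (Ideal.Quotient.mkₐ k J) := Subalgebra.mem_map.2 ⟨P, h1, rfl⟩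
      rw [AlgHom.map_adjoin, ← Set.image_comp] at h2
      exact h2
    · have hc : c ∈ cl B := by rw [hgen]; trivial
      refine (Subring.closure_le.2 ?_ : cl B ≤ φ.range) hc
      rintro _ (⟨c, rfl⟩ | hb)
      · exact ⟨_, hφC c⟩
      · exact ⟨_, hφx ⟨_, hb⟩⟩
  let e := RingEquiv.ofBijective φ hbij
  refine ⟨e.symm, fun c => ?_, fun b => ?_⟩
  · rw [RingHom.coe_coe, RingEquiv.symm_apply_eq, pow_one]
    exact (hφC c).symm
  · rw [RingHom.coe_coe, RingEquiv.symm_apply_eq]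
    exact (hφx b).symm

omit [Fact p.Prime] in
-- Frobenius applied to the statement for `n` shows that `k ^ p` lies in the ring generated by the
-- `p ^ (n + 1)`-th powers and `B`.
lemma closure_pow_union_eq_top {B : Set k} [Fact p.Prime]
    (h : Subring.closure (Set.range (fun c : k => c ^ p) ∪ B) = ⊤) (n : ℕ) :
    Subring.closure (Set.range (fun c : k => c ^ p ^ n) ∪ B) = ⊤ := by
  induction n with
  | zero =>
    rw [eq_top_iff]
    exact fun c _ => Subring.subset_closure (.inl ⟨c, by simp⟩)
  | succ n ih =>
    set S := Subring.closure (Set.range (fun c : k => c ^ p ^ (n + 1)) ∪ B)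
    have hB : B ⊆ S := fun b hb => Subring.subset_closure (.inr hb)
    have h1 : (⊤ : Subring k) ≤ S.comap (frobenius k p) := by
      rw [← ih, Subring.closure_le]
      rintro _ (⟨c, rfl⟩ | hb)
      · rw [SetLike.mem_coe, Subring.mem_comap, frobenius_def]
        exact Subring.subset_closure (.inl ⟨c, by simp only [pow_succ, pow_mul]⟩)
      · exact pow_mem (hB hb) p
    rw [eq_top_iff, ← h, Subring.closure_le]
    rintro _ (⟨c, rfl⟩ | hb)
    · exact h1 (show c ∈ (⊤ : Subring k) from trivial)
    · exact hB hb

end pBasis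

end Burch

/-! ### A discrete valuation ring inside a complete p-filtered ring -/

namespace Burch

set_option linter.unusedSectionVars false

/-- A complete filtered ring with residue field `k` of characteristic `p`, together with a map to a
domain in which `p` is nonzero and whose `p`-adic filtration controls the given one. -/
structure IsPFiltered (p : ℕ) {E k V : Type*} [CommRing E] [Field k] [CommRing V]
    (I : ℕ → Ideal E) (π : E →+* k) (w : E →+* V) : Prop where
  anti : Antitone I
  zero : I 0 = ⊤
  mul_mem : ∀ {i j x y}, x ∈ I i → y ∈ I j → x * y ∈ I (i + j)
  p_mem : (p : E) ∈ I 1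
  surj : Function.Surjective π
  ker : ∀ x, π x = 0 ↔ x ∈ I 1
  haus : ∀ x, (∀ n, x ∈ I n) → x = 0
  complete : ∀ f : ℕ → E, (∀ n, f (n + 1) - f n ∈ I n) → ∃ x, ∀ n, x - f n ∈ I n
  dvd : ∀ {n x}, x ∈ I n → (p : V) ^ n ∣ w x
  mem_of_dvd : ∀ {x}, (p : V) ∣ w x → x ∈ I 1
  ne_zero : (p : V) ≠ 0

section

variable {p : ℕ} [Fact p.Prime] {E k V : Type*} [CommRing E] [Field k] [CharP k p]
  [CommRing V] [IsDomain V] {I : ℕ → Ideal E} {π : E →+* k} {w : E →+* V}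

variable (p I) in
/-- Elements congruent to a value of the `n`-th ghost component modulo `I (n + 1)`. -/
noncomputable def ghostSubring (n : ℕ) : Subring E :=
  (((Ideal.Quotient.mk (I (n + 1))).comp
    (WittVector.ghostComponent n : WittVector p E →+* E)).range).comap
      (Ideal.Quotient.mk (I (n + 1)))

/-- That the ghost component is a ring homomorphism is what makes these sums closed under addition
and multiplication. -/
lemma mem_ghostSubring {n : ℕ} {x : E} : x ∈ ghostSubring p I n ↔
    ∃ a : ℕ → E, x - ∑ i ∈ Finset.range (n + 1), (p : E) ^ i * a i ^ p ^ (n - i) ∈ I (n + 1) := by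
  have key : ∀ a : WittVector p E, WittVector.ghostComponent n a =
      ∑ i ∈ Finset.range (n + 1), (p : E) ^ i * a.coeff i ^ p ^ (n - i) := fun a => by
    rw [WittVector.ghostComponent_apply, aeval_wittPolynomial]
  rw [ghostSubring, Subring.mem_comap, RingHom.mem_range]
  constructor
  · rintro ⟨a, ha⟩
    refine ⟨a.coeff, ?_⟩
    rw [← key, ← Ideal.Quotient.eq]
    exact ha.symm
  · rintro ⟨a, ha⟩
    refine ⟨WittVector.mk p a, ?_⟩
    rw [RingHom.comp_apply, key, eq_comm, Ideal.Quotient.eq]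
    exact ha

omit [Fact p.Prime] in
lemma IsPFiltered.p_pow_mem (h : IsPFiltered p I π w) (n : ℕ) : (p : E) ^ n ∈ I n := by
  induction n with
  | zero => rw [h.zero]; trivial
  | succ n ih => rw [pow_succ]; exact h.mul_mem ih h.p_mem

omit [Fact p.Prime] in
lemma IsPFiltered.pow_mem (h : IsPFiltered p I π w) {x : E} (hx : x ∈ I 1) (n : ℕ) :
    x ^ n ∈ I n := by
  induction n with
  | zero => rw [h.zero]; trivial
  | succ n ih => rw [pow_succ]; exact h.mul_mem ih hx

omit [Fact p.Prime] [CharP k p] in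
lemma IsPFiltered.p_mul_mem (h : IsPFiltered p I π w) {x : E} {n : ℕ} (hx : x ∈ I n) :
    p * x ∈ I (n + 1) := by
  rw [add_comm]
  exact h.mul_mem h.p_mem hx

lemma ghostSubring_of_mem {n : ℕ} {x : E} (hx : x ∈ I (n + 1)) : x ∈ ghostSubring p I n := by
  rw [ghostSubring, Subring.mem_comap, Ideal.Quotient.eq_zero_iff_mem.2 hx]
  exact zero_mem _

lemma pow_mem_ghostSubring (n : ℕ) (x : E) : x ^ p ^ n ∈ ghostSubring p I n := by
  refine mem_ghostSubring.2 ⟨fun i => if i = 0 then x else 0, ?_⟩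
  rw [Finset.sum_range_succ', Finset.sum_eq_zero]
  · simp
  · intro i hi
    have : p ^ (n - (i + 1)) ≠ 0 := pow_ne_zero _ (Fact.out : p.Prime).ne_zero
    simp only [Nat.succ_ne_zero, if_false, zero_pow this, mul_zero]

/-- The last term is a multiple of `p ^ (n + 1)`, hence negligible; the others are ghost terms in
the `a i ^ p`. -/
lemma ghostSubring_succ_le (h : IsPFiltered p I π w) (n : ℕ) :
    ghostSubring p I (n + 1) ≤ ghostSubring p I n := by
  intro x hx
  obtain ⟨a, ha⟩ := mem_ghostSubring.1 hx
  refine mem_ghostSubring.2 ⟨fun i => a i ^ p, ?_⟩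
  rw [Finset.sum_range_succ, ← sub_sub] at ha
  have h1 : ∑ i ∈ Finset.range (n + 1), (p : E) ^ i * a i ^ p ^ (n + 1 - i) =
      ∑ i ∈ Finset.range (n + 1), (p : E) ^ i * (a i ^ p) ^ p ^ (n - i) := by
    refine Finset.sum_congr rfl fun i hi => ?_
    have hi' : i ≤ n := Nat.lt_succ_iff.1 (Finset.mem_range.1 hi)
    rw [← pow_mul (a i), ← pow_succ', Nat.succ_sub hi']
  rw [h1] at ha
  have h2 := add_mem (h.anti (Nat.le_succ (n + 1)) ha)
    (Ideal.mul_mem_right (a (n + 1) ^ p ^ (n + 1 - (n + 1))) _ (h.p_pow_mem (n + 1)))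
  rwa [sub_add_cancel] at h2

omit [Fact p.Prime] in
lemma IsPFiltered.map_p (h : IsPFiltered p I π w) : π (p : E) = 0 := (h.ker _).2 h.p_mem

lemma map_ghost_sum (h : IsPFiltered p I π w) {n : ℕ} {x : E} {a : ℕ → E}
    (ha : x - ∑ i ∈ Finset.range (n + 1), (p : E) ^ i * a i ^ p ^ (n - i) ∈ I (n + 1)) :
    π x = π (a 0) ^ p ^ n := by
  have h1 := (h.ker _).2 (h.anti (Nat.le_add_left 1 n) ha)
  rw [map_sub, sub_eq_zero] at h1
  rw [h1, Finset.sum_range_succ', map_add, map_sum, Finset.sum_eq_zero]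
  · simp
  · intro i _
    rw [map_mul, map_pow, h.map_p, zero_pow (Nat.succ_ne_zero i), zero_mul]

/-- Zero residue forces `a 0 ∈ I 1`, so `a 0 ^ p ^ (n + 1)` lies in `I (n + 2)`. All remaining terms
are divisible by `p`. -/
lemma exists_of_mem_ghostSubring (h : IsPFiltered p I π w) {n : ℕ} {x : E}
    (hx : x ∈ ghostSubring p I (n + 1)) (h0 : π x = 0) :
    ∃ y ∈ ghostSubring p I n, x - p * y ∈ I (n + 2) := by
  have hp : p.Prime := Fact.out
  obtain ⟨a, ha⟩ := mem_ghostSubring.1 hx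
  rw [map_ghost_sum h ha] at h0
  have ha0 : a 0 ∈ I 1 := (h.ker _).1 ((pow_eq_zero_iff (pow_ne_zero _ hp.ne_zero)).1 h0)
  refine ⟨∑ i ∈ Finset.range (n + 1), (p : E) ^ i * a (i + 1) ^ p ^ (n - i),
    mem_ghostSubring.2 ⟨fun i => a (i + 1), by simp⟩, ?_⟩
  rw [Finset.sum_range_succ', ← sub_sub] at ha
  have h1 : a 0 ^ p ^ (n + 1) ∈ I (n + 2) :=
    h.anti (Nat.lt_pow_self hp.one_lt) (h.pow_mem ha0 _)
  have h2 := add_mem ha h1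
  simp only [pow_zero, one_mul, Nat.sub_zero, sub_add_cancel] at h2
  convert! h2 using 2
  rw [Finset.mul_sum]
  refine Finset.sum_congr rfl fun i _ => ?_
  rw [pow_succ', mul_assoc, Nat.add_sub_add_right]

variable (p I) in
/-- The subring generated by ghost components and lifts of the elements of a `p`-basis. -/
noncomputable def levelSubring (B : Set k) (s : k → E) (n : ℕ) : Subring E :=
  Subring.closure (ghostSubring p I n ∪ s '' B)

variable {B : Set k} {s : k → E}

omit [CharP k p] in
lemma ghostSubring_le_levelSubring (n : ℕ) :
    ghostSubring p I n ≤ levelSubring p I B s n :=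
  fun _ hx => Subring.subset_closure (.inl hx)

omit [CharP k p] in
lemma lift_mem_levelSubring (n : ℕ) {b : k} (hb : b ∈ B) : s b ∈ levelSubring p I B s n :=
  Subring.subset_closure (.inr ⟨b, hb, rfl⟩)

omit [CharP k p] in
lemma levelSubring_of_mem {n : ℕ} {x : E} (hx : x ∈ I (n + 1)) :
    x ∈ levelSubring p I B s n :=
  ghostSubring_le_levelSubring n (ghostSubring_of_mem hx)

lemma antitone_levelSubring (h : IsPFiltered p I π w) : Antitone (levelSubring p I B s) :=
  antitone_nat_of_succ_le fun n => Subring.closure_mono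
    (Set.union_subset_union_left _ (ghostSubring_succ_le h n))

lemma levelSubring_surjective (hs : ∀ c, π (s c) = c)
    (hB : Subring.closure (Set.range (fun c : k => c ^ p) ∪ B) = ⊤) (n : ℕ) (c : k) :
    ∃ d ∈ levelSubring p I B s n, π d = c := by
  have h1 : Subring.closure (Set.range (fun c : k => c ^ p ^ n) ∪ B) ≤
      (levelSubring p I B s n).map π := by
    rw [Subring.closure_le]
    rintro _ (⟨c, rfl⟩ | hb)
    · exact ⟨s c ^ p ^ n, ghostSubring_le_levelSubring n (pow_mem_ghostSubring n _), by simp [hs]⟩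
    · exact ⟨_, lift_mem_levelSubring n hb, hs _⟩
  rw [closure_pow_union_eq_top p hB n] at h1
  exact h1 (show c ∈ (⊤ : Subring k) from trivial)

/-- An element of the level subring with zero residue is divisible by `p` one level below. -/
lemma exists_of_mem_levelSubring (h : IsPFiltered p I π w) (hs : ∀ c, π (s c) = c)
    (hB : HasRootHom p B 1) {n : ℕ} {x : E} (hx : x ∈ levelSubring p I B s (n + 1))
    (h0 : π x = 0) : ∃ y ∈ levelSubring p I B s n, x - p * y ∈ I (n + 2) := by
  set D := levelSubring p I B s (n + 1) with hD
  let N : Ideal D :=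
    { carrier := {x | ∃ y ∈ levelSubring p I B s n, (x : E) - p * y ∈ I (n + 2)}
      add_mem' := by
        rintro a b ⟨y, hy, hay⟩ ⟨z, hz, hbz⟩
        refine ⟨y + z, add_mem hy hz, ?_⟩
        convert! add_mem hay hbz using 1
        push_cast
        ring
      zero_mem' := ⟨0, zero_mem _, by simp⟩
      smul_mem' := by
        rintro c a ⟨y, hy, hay⟩
        refine ⟨c * y, mul_mem (antitone_levelSubring h (Nat.le_succ n) c.2) hy, ?_⟩
        convert! Ideal.mul_mem_left _ (c : E) hay using 1
        rw [smul_eq_mul]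
        push_cast
        ring }
  have hN : ∀ a b : D, (a : E) ∈ ghostSubring p I (n + 1) → (b : E) ∈ ghostSubring p I (n + 1) →
      π a = π b → Ideal.Quotient.mk N a = Ideal.Quotient.mk N b := by
    intro a b ha hb hab
    rw [Ideal.Quotient.eq]
    obtain ⟨y, hy, hy'⟩ := exists_of_mem_ghostSubring h (sub_mem ha hb)
      (by rw [map_sub, hab, sub_self])
    exact ⟨y, ghostSubring_le_levelSubring n hy, hy'⟩
  let t : k → D := fun c =>
    ⟨s c ^ p ^ (n + 1), ghostSubring_le_levelSubring _ (pow_mem_ghostSubring _ _)⟩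
  have ht : ∀ c, (t c : E) ∈ ghostSubring p I (n + 1) := fun c => pow_mem_ghostSubring _ _
  have htπ : ∀ c, π (t c) = c ^ p ^ (n + 1) := fun c => by simp [t, hs]
  -- Modulo `N` an element of the ghost subring depends only on its residue, so powers of arbitrary
  -- lifts become additive and multiplicative.
  let g : k →+* D ⧸ N :=
    { toFun := fun c => Ideal.Quotient.mk N (t c)
      map_one' := by
        rw [← map_one (Ideal.Quotient.mk N)]
        exact hN _ _ (ht _) (one_mem _) (by simp [htπ])
      map_mul' := fun a b => by
        rw [← map_mul]
        exact hN _ _ (ht _) (mul_mem (ht _) (ht _)) (by simp [htπ, mul_pow])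
      map_zero' := by
        have hp : p ^ (n + 1) ≠ 0 := pow_ne_zero _ (Fact.out : p.Prime).ne_zero
        rw [← map_zero (Ideal.Quotient.mk N)]
        exact hN _ _ (ht _) (zero_mem _) (by rw [htπ, zero_pow hp, Subring.coe_zero, map_zero])
      map_add' := fun a b => by
        rw [← map_add]
        refine hN _ _ (ht _) (add_mem (ht _) (ht _)) ?_
        rw [htπ, Subring.coe_add, map_add, htπ, htπ, add_pow_char_pow] }
  obtain ⟨ψ, hψ, hψ'⟩ := hB.all p (n + 1)
  let Φ : MvPolynomial B k ⧸ rootIdeal p B (n + 1) →+* D ⧸ N :=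
    Ideal.Quotient.lift _ (MvPolynomial.eval₂Hom g fun b : B =>
      Ideal.Quotient.mk N ⟨s b, lift_mem_levelSubring _ b.2⟩) (by
        intro a ha
        rw [← RingHom.mem_ker]
        refine (Ideal.span_le.2 ?_) ha
        rintro _ ⟨b, rfl⟩
        rw [SetLike.mem_coe, RingHom.mem_ker, map_sub, sub_eq_zero]
        simp only [map_pow, MvPolynomial.coe_eval₂Hom, MvPolynomial.eval₂_X,
          MvPolynomial.eval₂_C]
        rw [← map_pow]
        rfl)
  -- The class modulo `N` is a function of the residue, through the root homomorphism; so residue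
  -- zero puts `x` in `N`.
  have key : ∀ x (hx : x ∈ D), Ideal.Quotient.mk N ⟨x, hx⟩ = Φ (ψ (π x)) := by
    intro x hx
    induction hx using Subring.closure_induction with
    | mem x hx =>
      rcases hx with hx | ⟨b, hb, rfl⟩
      · obtain ⟨a, ha⟩ := mem_ghostSubring.1 hx
        have h1 := map_ghost_sum h ha
        have h2 : Φ (Ideal.Quotient.mk _ (MvPolynomial.C (π (a 0)))) = g (π (a 0)) := by
          simp [Φ]
        rw [h1, hψ, h2]
        exact hN _ _ hx (ht _) (by rw [htπ, h1])
      · rw [hs, hψ' ⟨b, hb⟩]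
        simp [Φ]
    | zero => rw [map_zero, map_zero, map_zero]; exact map_zero _
    | one => rw [map_one, map_one, map_one]; exact map_one _
    | add x y _ _ hx hy => rw [map_add, map_add, map_add, ← hx, ← hy, ← map_add]; rfl
    | mul x y _ _ hx hy => rw [map_mul, map_mul, map_mul, ← hx, ← hy, ← map_mul]; rfl
    | neg x _ hx => rw [map_neg, map_neg, map_neg, ← hx, ← map_neg]; rfl
  have h1 := key x hx
  rw [h0, map_zero, map_zero, Ideal.Quotient.eq_zero_iff_mem] at h1
  exact h1

variable (p I) in
/-- The coefficient ring attached to lifts of a `p`-basis. -/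
noncomputable def coeffSubring (B : Set k) (s : k → E) : Subring E := ⨅ n, levelSubring p I B s n

lemma mem_coeffSubring {x : E} :
    x ∈ coeffSubring p I B s ↔ ∀ n, x ∈ levelSubring p I B s n := Subring.mem_iInf

lemma mem_coeffSubring_of_forall {x : E}
    (hx : ∀ n, ∃ y ∈ coeffSubring p I B s, x - y ∈ I n) : x ∈ coeffSubring p I B s := by
  refine mem_coeffSubring.2 fun n => ?_
  obtain ⟨y, hy, hxy⟩ := hx (n + 1)
  have := add_mem (levelSubring_of_mem (B := B) (s := s) (p := p) hxy) (mem_coeffSubring.1 hy n)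
  rwa [sub_add_cancel] at this

section

variable (h : IsPFiltered p I π w) (hs : ∀ c, π (s c) = c)
  (hB : Subring.closure (Set.range (fun c : k => c ^ p) ∪ B) = ⊤) (hB' : HasRootHom p B 1)

include h hs hB hB'

/-- Dividing by `p` costs one level. The quotient is split as a deep element with the same residue
plus an element of residue zero, on which the induction continues. -/
lemma exists_levelSubring_of_residue_zero (n N : ℕ) {x : E} (hx : x ∈ levelSubring p I B s n)
    (h0 : π x = 0) : ∃ y ∈ levelSubring p I B s N, x - p * y ∈ I (n + 1) := by
  induction n generalizing x with
  | zero => exact ⟨0, zero_mem _, by simpa using (h.ker x).1 h0⟩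
  | succ n ih =>
    obtain ⟨e, he, hxe⟩ := exists_of_mem_levelSubring h hs hB' hx h0
    obtain ⟨e', he', hee⟩ := levelSubring_surjective hs hB (max n N) (π e)
    obtain ⟨z, hz, hez⟩ := ih (sub_mem he (antitone_levelSubring h (le_max_left n N) he'))
      (by rw [map_sub, hee, sub_self])
    refine ⟨e' + p * z, add_mem (antitone_levelSubring h (le_max_right n N) he')
      (mul_mem (natCast_mem _ _) hz), ?_⟩
    have := add_mem hxe (h.p_mul_mem hez)
    convert! this using 1
    ring

lemma exists_levelSubring_sub_mem (n N : ℕ) {x : E} (hx : x ∈ levelSubring p I B s n) :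
    ∃ y ∈ levelSubring p I B s N, x - y ∈ I (n + 1) := by
  obtain ⟨e, he, hee⟩ := levelSubring_surjective hs hB (max n N) (π x)
  obtain ⟨z, hz, hez⟩ := exists_levelSubring_of_residue_zero h hs hB hB' n N
    (sub_mem hx (antitone_levelSubring h (le_max_left n N) he)) (by rw [map_sub, hee, sub_self])
  refine ⟨e + p * z, add_mem (antitone_levelSubring h (le_max_right n N) he)
      (mul_mem (natCast_mem _ _) hz), ?_⟩
  rwa [← sub_sub]

/-- Successive approximations at ever deeper levels converge, and the limit is in every level
because level `m` contains `I (m + 1)`. -/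
lemma exists_coeffSubring_sub_mem (n : ℕ) {x : E} (hx : x ∈ levelSubring p I B s n) :
    ∃ y ∈ coeffSubring p I B s, x - y ∈ I (n + 1) := by
  choose F hF hF' using fun (m : ℕ) (y : levelSubring p I B s m) =>
    exists_levelSubring_sub_mem h hs hB hB' m (m + 1) y.2
  let f : (m : ℕ) → levelSubring p I B s (n + m) :=
    fun m => Nat.rec ⟨x, hx⟩ (fun m y => ⟨F (n + m) y, hF (n + m) y⟩) m
  have hf : ∀ m, ((f (m + 1)).1 : E) - (f m).1 ∈ I (n + m + 1) := fun m => by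
    have := neg_mem (hF' (n + m) (f m))
    rw [neg_sub] at this
    exact this
  obtain ⟨d, hd⟩ := h.complete (fun m => (f m).1) fun m => h.anti (by lia) (hf m)
  -- Completeness only gives `I m`; comparison with a much later term restores the sharp exponent.
  have hd' : ∀ m, d - (f m).1 ∈ I (n + m + 1) := by
    have : ∀ m j, (f (m + j)).1 - (f m).1 ∈ I (n + m + 1) := by
      intro m j
      induction j with
      | zero => simp
      | succ j ih =>
        have := add_mem (h.anti (by lia : n + m + 1 ≤ n + (m + j) + 1) (hf (m + j))) ih
        rwa [sub_add_sub_cancel] at this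
    intro m
    have := add_mem (h.anti (by lia) (hd (m + (n + m + 1)))) (this m (n + m + 1))
    rwa [sub_add_sub_cancel] at this
  refine ⟨d, mem_coeffSubring.2 fun m => ?_, ?_⟩
  · have h1 := add_mem (levelSubring_of_mem (B := B) (s := s) (p := p) (hd' m)) (f m).2
    rw [sub_add_cancel] at h1
    exact antitone_levelSubring h (Nat.le_add_left m n) h1
  · rw [← neg_sub]
    exact neg_mem (hd' 0)

lemma coeffSubring_surjective (c : k) : ∃ d ∈ coeffSubring p I B s, π d = c := by
  obtain ⟨x, hx, rfl⟩ := levelSubring_surjective hs hB 0 c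
  obtain ⟨y, hy, hxy⟩ := exists_coeffSubring_sub_mem h hs hB hB' 0 hx
  have := (h.ker _).2 hxy
  rw [map_sub, sub_eq_zero] at this
  exact ⟨y, hy, this.symm⟩

lemma exists_coeffSubring_of_residue_zero (n : ℕ) {x : E} (hx : x ∈ coeffSubring p I B s)
    (h0 : x ∈ I 1) : ∃ y ∈ coeffSubring p I B s, x - p * y ∈ I (n + 1) := by
  obtain ⟨e, he, hxe⟩ := exists_levelSubring_of_residue_zero h hs hB hB' n n
    (mem_coeffSubring.1 hx n) ((h.ker x).2 h0)
  obtain ⟨y, hy, hey⟩ := exists_coeffSubring_sub_mem h hs hB hB' n he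
  refine ⟨y, hy, ?_⟩
  have := add_mem hxe (Ideal.mul_mem_left _ (p : E) hey)
  convert! this using 1
  ring

/-- On the coefficient ring `w` detects the filtration: `x` is `p y` up to a negligible error, and
`p` can be cancelled in the domain `V`. -/
lemma mem_of_pow_dvd (n : ℕ) {x : E} (hx : x ∈ coeffSubring p I B s)
    (hw : (p : V) ^ n ∣ w x) : x ∈ I n := by
  induction n generalizing x with
  | zero => rw [h.zero]; trivial
  | succ n ih =>
    obtain ⟨y, hy, hxy⟩ := exists_coeffSubring_of_residue_zero h hs hB hB' n hx
      (h.mem_of_dvd ((dvd_pow_self _ (Nat.succ_ne_zero n)).trans hw))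
    have h1 : (p : V) ^ (n + 1) ∣ w (p * y) := by
      have := dvd_sub hw (h.dvd hxy)
      rwa [← map_sub, sub_sub_cancel] at this
    rw [map_mul, map_natCast, pow_succ'] at h1
    have h2 := ih hy ((mul_dvd_mul_iff_left h.ne_zero).1 h1)
    have := add_mem hxy (h.p_mul_mem h2)
    rwa [sub_add_cancel] at this

/-- Approximate quotients by `p` form a Cauchy sequence: `p` may be a zero divisor in `E`, but it
cancels after applying `w`, and `mem_of_pow_dvd` carries the estimate back. -/
lemma exists_eq_p_mul {x : E} (hx : x ∈ coeffSubring p I B s) (h0 : x ∈ I 1) :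
    ∃ y ∈ coeffSubring p I B s, x = p * y := by
  choose e he hxe using fun n => exists_coeffSubring_of_residue_zero h hs hB hB' n hx h0
  obtain ⟨y, hy⟩ := h.complete e fun n => by
    refine mem_of_pow_dvd h hs hB hB' n (sub_mem (he _) (he _)) ?_
    have h1 : p * (e (n + 1) - e n) ∈ I (n + 1) := by
      have := sub_mem (hxe n) (h.anti (Nat.le_succ (n + 1)) (hxe (n + 1)))
      convert! this using 1
      ring
    have h2 := h.dvd h1
    rw [map_mul, map_natCast, pow_succ'] at h2
    exact (mul_dvd_mul_iff_left h.ne_zero).1 h2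
  refine ⟨y, mem_coeffSubring_of_forall fun n => ⟨e n, he n, hy n⟩, ?_⟩
  rw [← sub_eq_zero]
  refine h.haus _ fun n => ?_
  have := sub_mem (h.anti (Nat.le_succ n) (hxe n)) (Ideal.mul_mem_left _ (p : E) (hy n))
  convert! this using 1
  ring

/-- Lift the inverse of the residue and correct it by a geometric series, whose sum stays in the
closed subring. -/
lemma isUnit_of_notMem (x : coeffSubring p I B s) (hx : (x : E) ∉ I 1) : IsUnit x := by
  have hπ : π x ≠ 0 := fun h0 => hx ((h.ker _).1 h0)
  obtain ⟨y, hy, hxy⟩ := coeffSubring_surjective h hs hB hB' (π x)⁻¹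
  set z : E := 1 - x * y with hz
  have hz1 : z ∈ I 1 := by
    rw [← h.ker, hz, map_sub, map_mul, hxy, map_one, mul_inv_cancel₀ hπ, sub_self]
  have hzD : z ∈ coeffSubring p I B s := sub_mem (one_mem _) (mul_mem x.2 hy)
  let S : ℕ → E := fun n => ∑ i ∈ Finset.range n, z ^ i
  obtain ⟨u, hu⟩ := h.complete S fun n => by
    simp only [S, Finset.sum_range_succ, add_sub_cancel_left]
    exact h.pow_mem hz1 n
  have huD : u ∈ coeffSubring p I B s := mem_coeffSubring_of_forall fun n =>
    ⟨S n, sum_mem fun i _ => pow_mem hzD i, hu n⟩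
  have h1 : (x : E) * (y * u) = 1 := by
    rw [← sub_eq_zero]
    refine h.haus _ fun n => ?_
    have h2 := mul_neg_geom_sum z n
    have h3 := sub_mem (Ideal.mul_mem_left _ (1 - z) (hu n)) (h.pow_mem hz1 n)
    convert! h3 using 1
    have h4 : (1 - z) = x * y := by rw [hz]; ring
    rw [mul_sub, h2, h4]
    ring
  exact IsUnit.of_mul_eq_one (⟨y * u, mul_mem hy huD⟩ : coeffSubring p I B s) (Subtype.ext h1)

lemma coeffSubring_isLocalRing : IsLocalRing (coeffSubring p I B s) := by
  have h1 : (1 : E) ∉ I 1 := fun h1 => one_ne_zero ((map_one π).symm.trans ((h.ker _).2 h1))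
  have : Nontrivial (coeffSubring p I B s) :=
    ⟨0, 1, fun h01 => h1 (by
      rw [show (1 : E) = 0 from (congrArg Subtype.val h01).symm]; exact zero_mem _)⟩
  refine IsLocalRing.of_isUnit_or_isUnit_one_sub_self fun a => ?_
  by_cases ha : (a : E) ∈ I 1
  · refine .inr (isUnit_of_notMem h hs hB hB' _ fun ha' => h1 ?_)
    have := add_mem ha' ha
    simpa using this
  · exact .inl (isUnit_of_notMem h hs hB hB' _ ha)

lemma coeffSubring_isDomain : IsDomain (coeffSubring p I B s) := by
  have := coeffSubring_isLocalRing h hs hB hB'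
  refine Function.Injective.isDomain (w.comp (coeffSubring p I B s).subtype) ?_
  rw [injective_iff_map_eq_zero]
  intro x hx
  refine Subtype.ext (h.haus _ fun n => mem_of_pow_dvd h hs hB hB' n x.2 ?_)
  have : w (x : E) = 0 := hx
  rw [this]
  exact dvd_zero _

lemma coeffSubring_isDVR : ∃ _ : IsDomain (coeffSubring p I B s),
    IsDiscreteValuationRing (coeffSubring p I B s) := by
  have hdom := coeffSubring_isDomain h hs hB hB'
  have hloc := coeffSubring_isLocalRing h hs hB hB'
  have hp0 : ((p : coeffSubring p I B s) : E) = p := by simp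
  have hpne : (p : coeffSubring p I B s) ≠ 0 := fun h0 => by
    have h1 : w (p : E) = 0 := by rw [← hp0, h0]; simp
    rw [map_natCast] at h1
    exact h.ne_zero h1
  have hpm : (p : coeffSubring p I B s) ∈ IsLocalRing.maximalIdeal (coeffSubring p I B s) := by
    rw [IsLocalRing.mem_maximalIdeal, mem_nonunits_iff]
    intro hu
    have h1 := hu.map (π.comp (coeffSubring p I B s).subtype)
    rw [map_natCast, CharP.cast_eq_zero] at h1
    exact not_isUnit_zero h1
  have hmax : IsLocalRing.maximalIdeal (coeffSubring p I B s) = Ideal.span {↑p} := by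
    refine le_antisymm (fun x hx => ?_) (Ideal.span_le.2 (by simpa using hpm))
    have hx1 : (x : E) ∈ I 1 := by
      by_contra hx1
      exact hx (isUnit_of_notMem h hs hB hB' x hx1)
    obtain ⟨y, hy, hxy⟩ := exists_eq_p_mul h hs hB hB' x.2 hx1
    exact Ideal.mem_span_singleton'.2 ⟨⟨y, hy⟩, Subtype.ext (by rw [hxy]; simp [mul_comm])⟩
  have hirr : Irreducible (p : coeffSubring p I B s) := by
    refine (Ideal.span_singleton_prime hpne).1 ?_ |>.irreducible
    rw [← hmax]
    infer_instance
  refine ⟨hdom, IsDiscreteValuationRing.ofHasUnitMulPowIrreducibleFactorization ⟨p, hirr, ?_⟩⟩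
  intro x hx
  obtain ⟨n, hn⟩ : ∃ n, ¬ (p : coeffSubring p I B s) ^ n ∣ x := by
    by_contra! hall
    refine hx (Subtype.ext (h.haus _ fun n => ?_))
    obtain ⟨y, hy⟩ := hall n
    rw [hy]
    push_cast
    exact Ideal.mul_mem_right _ _ (h.p_pow_mem n)
  obtain ⟨m, hm1, hm2⟩ : ∃ m, (p : coeffSubring p I B s) ^ m ∣ x ∧
      ¬ (p : coeffSubring p I B s) ^ (m + 1) ∣ x := by
    by_contra! hall
    refine hn ?_
    clear hn
    induction n with
    | zero => simp
    | succ n ih => exact hall n ih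
  obtain ⟨u, rfl⟩ := hm1
  have hu : IsUnit u := by
    by_contra hu
    have : u ∈ IsLocalRing.maximalIdeal (coeffSubring p I B s) := hu
    rw [hmax, Ideal.mem_span_singleton] at this
    exact hm2 (by rw [pow_succ]; exact mul_dvd_mul_left _ this)
  obtain ⟨u, rfl⟩ := hu
  exact ⟨m, u, rfl⟩

end

/-- A complete filtered ring of mixed type contains a discrete valuation ring which is surjective on
the residue field. -/
theorem IsPFiltered.exists_isDVR (h : IsPFiltered p I π w) :
    ∃ (D : Subring E) (_ : IsDomain D), IsDiscreteValuationRing D ∧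
      ∀ c, ∃ d ∈ D, π d = c := by
  obtain ⟨B, hB, hB'⟩ := exists_pBasis k p
  choose s hs using h.surj
  obtain ⟨h1, h2⟩ := coeffSubring_isDVR h hs hB hB'
  exact ⟨coeffSubring p I B s, h1, h2, coeffSubring_surjective h hs hB hB'⟩

end

end Burch

/-! ### Cohen's structure theorem -/

namespace Burch

open IsLocalRing

lemma exists_sub_mem_pow_of_isAdicComplete {R : Type*} [CommRing R] (J : Ideal R)
    [IsAdicComplete J R] (f : ℕ → R) (hf : ∀ n, f (n + 1) - f n ∈ J ^ n) :
    ∃ x, ∀ n, x - f n ∈ J ^ n := by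
  have hJ : ∀ n, (J ^ n • ⊤ : Submodule R R) = J ^ n := fun n => by
    rw [smul_eq_mul, Ideal.mul_top]
  obtain ⟨x, hx⟩ := IsPrecomplete.prec (inferInstance : IsPrecomplete J R) (f := f) (by
    intro m n hmn
    rw [hJ]
    induction n, hmn using Nat.le_induction with
    | base => rfl
    | succ n hmn ih =>
      refine ih.trans (SModEq.symm (SModEq.sub_mem.2 ?_))
      exact Ideal.pow_le_pow_right hmn (hf n))
  refine ⟨x, fun n => ?_⟩
  have := (hx n).symm
  rwa [hJ, SModEq.sub_mem] at this

lemma eq_zero_of_forall_mem_pow {R : Type*} [CommRing R] (J : Ideal R) [IsHausdorff J R] {x : R}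
    (hx : ∀ n, x ∈ J ^ n) : x = 0 := by
  refine IsHausdorff.haus (inferInstance : IsHausdorff J R) x fun n => ?_
  rw [SModEq.zero, smul_eq_mul, Ideal.mul_top]
  exact hx n

lemma charZero_of_ringHom {R S : Type*} [NonAssocSemiring R] [NonAssocSemiring S] [CharZero S]
    (f : R →+* S) : CharZero R :=
  ⟨fun a b hab => by
    have := congrArg f hab
    simpa using this⟩

lemma nonempty_algebraRat_of_isLocalRing (Q : Type*) [CommRing Q] [IsLocalRing Q]
    [CharZero (ResidueField Q)] : Nonempty (Algebra ℚ Q) := by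
  rw [EqualCharZero.nonempty_algebraRat_iff]
  intro I hI
  have := IsLocalRing.le_maximalIdeal hI
  have : CharZero (Q ⧸ maximalIdeal Q) := ‹CharZero (ResidueField Q)›
  exact charZero_of_ringHom (Ideal.Quotient.factor ‹I ≤ maximalIdeal Q›)

/-- In characteristic zero `k` is separable algebraic over a purely transcendental extension. -/
lemma formallySmooth_rat (k : Type*) [Field k] [Algebra ℚ k] : Algebra.FormallySmooth ℚ k := by
  obtain ⟨s, hs⟩ := exists_isTranscendenceBasis ℚ k
  have := hs.isAlgebraic_field
  have : CharZero (IntermediateField.adjoin ℚ (Set.range ((↑) : s → k))) :=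
    charZero_of_injective_algebraMap (R := ℚ) (algebraMap ℚ _).injective
  exact .of_algebraicIndependent_of_isSeparable hs.1

/-- A complete local ring with residue field of characteristic zero contains a coefficient field. -/
lemma exists_coefficientField (Q : Type*) [CommRing Q] [IsLocalRing Q]
    [IsAdicComplete (maximalIdeal Q) Q] [CharZero (ResidueField Q)] :
    ∃ g : ResidueField Q →+* Q, Function.Surjective ((residue Q).comp g) := by
  obtain ⟨_⟩ := nonempty_algebraRat_of_isLocalRing Q
  have := formallySmooth_rat (ResidueField Q)
  obtain ⟨g, hg⟩ := Algebra.FormallySmooth.exists_mkₐ_comp_eq_of_isAdicComplete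
    (R := ℚ) (A := ResidueField Q) (S := Q) (I := maximalIdeal Q)
    (RingHom.toRatAlgHom (RingHom.id (ResidueField Q) : ResidueField Q →+* Q ⧸ maximalIdeal Q))
  exact ⟨g, fun c => ⟨c, DFunLike.congr_fun hg c⟩⟩

/-- A complete local ring with residue field of characteristic `p` receives a map from a discrete
valuation ring which is surjective onto the residue field. -/
lemma exists_coefficientRing_of_charP (Q : Type u) [CommRing Q] [IsLocalRing Q]
    [IsAdicComplete (maximalIdeal Q) Q] (p : ℕ) [Fact p.Prime] [CharP (ResidueField Q) p] :
    ∃ (D : Type u) (_ : CommRing D) (_ : IsDomain D) (_ : IsDiscreteValuationRing D)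
      (g : D →+* Q), Function.Surjective ((residue Q).comp g) := by
  let K := AlgebraicClosure (ResidueField Q)
  have : CharP K p := charP_of_injective_algebraMap (algebraMap (ResidueField Q) K).injective p
  let V := WittVector p K
  let cc : V →+* K := WittVector.constantCoeff
  have hcc : ∀ v : V, (p : V) ∣ v ↔ cc v = 0 := fun v => by
    rw [← Ideal.mem_span_singleton]
    exact WittVector.mem_span_p_iff_coeff_zero_eq_zero v
  let a : Q × V →+* K := ((algebraMap (ResidueField Q) K).comp (residue Q)).comp (RingHom.fst Q V)
  let b : Q × V →+* K := cc.comp (RingHom.snd Q V)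
  -- `p` may be nilpotent in `Q`. The fibre product with the Witt vectors of an algebraic closure
  -- adds a coordinate in a domain where `p` is nonzero, without changing the residue field.
  let E : Subring (Q × V) := a.eqLocus b
  let fE : E →+* Q := (RingHom.fst Q V).comp E.subtype
  let w : E →+* V := (RingHom.snd Q V).comp E.subtype
  have hE : ∀ x : E, algebraMap (ResidueField Q) K (residue Q (fE x)) = cc (w x) := fun x => x.2
  let J : Ideal V := Ideal.span {(p : V)}
  have hJ : ∀ n v, v ∈ J ^ n ↔ (p : V) ^ n ∣ v := fun n v => by
    rw [Ideal.span_singleton_pow, Ideal.mem_span_singleton]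
  let I : ℕ → Ideal E := fun n => (maximalIdeal Q ^ n).comap fE ⊓ (J ^ n).comap w
  have hI : ∀ n x, x ∈ I n ↔ fE x ∈ maximalIdeal Q ^ n ∧ w x ∈ J ^ n := fun n x => Iff.rfl
  have hm : ∀ r : Q, r ∈ maximalIdeal Q ↔ residue Q r = 0 := fun r =>
    (residue_eq_zero_iff r).symm
  have hker : ∀ x : E, residue Q (fE x) = 0 ↔ (p : V) ∣ w x := fun x => by
    rw [hcc, ← hE, map_eq_zero (algebraMap (ResidueField Q) K)]
  have hI1 : ∀ x : E, x ∈ I 1 ↔ residue Q (fE x) = 0 := fun x => by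
    rw [hI, pow_one, hm, hJ, pow_one, hker, and_self]
  have h : IsPFiltered p I ((residue Q).comp fE) w :=
    { anti := fun i j hij x hx =>
        ⟨Ideal.pow_le_pow_right hij hx.1, Ideal.pow_le_pow_right hij hx.2⟩
      zero := by simp [I, Ideal.one_eq_top]
      mul_mem := fun {i j x y} hx hy => by
        rw [hI, map_mul, map_mul, pow_add, pow_add]
        exact ⟨Ideal.mul_mem_mul hx.1 hy.1, Ideal.mul_mem_mul hx.2 hy.2⟩
      p_mem := by rw [hI1, map_natCast, map_natCast, CharP.cast_eq_zero]
      surj := fun c => by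
        obtain ⟨r, rfl⟩ := residue_surjective c
        obtain ⟨v, hv⟩ := WittVector.constantCoeff_surjective p
          (algebraMap (ResidueField Q) K (residue Q r))
        exact ⟨⟨(r, v), hv.symm⟩, rfl⟩
      ker := fun x => (hI1 x).symm
      haus := fun x hx => Subtype.ext (Prod.ext
        (eq_zero_of_forall_mem_pow (maximalIdeal Q) fun n => (hx n).1)
        (eq_zero_of_forall_mem_pow J fun n => (hx n).2))
      complete := fun f hf => by
        obtain ⟨r, hr⟩ := exists_sub_mem_pow_of_isAdicComplete (maximalIdeal Q) (fun n => fE (f n))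
          fun n => by rw [← map_sub]; exact (hf n).1
        obtain ⟨v, hv⟩ := exists_sub_mem_pow_of_isAdicComplete J (fun n => w (f n))
          fun n => by rw [← map_sub]; exact (hf n).2
        have h1 := hr 1
        rw [pow_one, hm, map_sub, sub_eq_zero] at h1
        have h2 := hv 1
        rw [hJ, pow_one, hcc, map_sub, sub_eq_zero] at h2
        have hrv : (r, v) ∈ E := by
          change algebraMap (ResidueField Q) K (residue Q r) = cc v
          rw [h1, h2, hE]
        refine ⟨⟨(r, v), hrv⟩, fun n => ?_⟩
        rw [hI, map_sub, map_sub]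
        exact ⟨hr n, hv n⟩
      dvd := fun {n x} hx => (hJ n _).1 hx.2
      mem_of_dvd := fun {x} hx => by rwa [hI1, hker]
      ne_zero := WittVector.p_nonzero p K }
  obtain ⟨D, hD, hD', hs⟩ := h.exists_isDVR
  refine ⟨D, inferInstance, hD, hD', fE.comp D.subtype, fun c => ?_⟩
  obtain ⟨d, hd, rfl⟩ := hs c
  exact ⟨⟨d, hd⟩, rfl⟩

/-- Cohen's structure theorem: a complete local ring with finitely generated maximal ideal is a
quotient of a regular local ring. -/
theorem exists_regular_surjection (Q : Type u) [CommRing Q] [IsLocalRing Q]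
    [IsAdicComplete (maximalIdeal Q) Q] (hfg : (maximalIdeal Q).FG) :
    ∃ (A : Type u) (_ : CommRing A) (_ : IsRegularLocalRing A) (f : A →+* Q),
      HasRegularParameters A ∧ Function.Surjective f := by
  obtain ⟨p, hp⟩ := CharP.exists (ResidueField Q)
  rcases CharP.char_is_prime_or_zero (ResidueField Q) p with hp' | rfl
  · have : Fact p.Prime := ⟨hp'⟩
    obtain ⟨D, _, _, _, g, hg⟩ := exists_coefficientRing_of_charP Q p
    exact exists_regular_presentation
      (hasRegularParameters_of_isPrincipal (IsPrincipalIdealRing.principal _).principal) hfg g hg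
  · have : CharZero (ResidueField Q) := CharP.charP_to_charZero _
    obtain ⟨g, hg⟩ := exists_coefficientField Q
    exact exists_regular_presentation (D := ResidueField Q)
      (hasRegularParameters_of_isPrincipal (IsPrincipalIdealRing.principal _).principal) hfg g hg

end Burch

/-! ### Invariance of the socle condition under completion -/

namespace Burch

open IsLocalRing TensorProduct

/-- The formal properties of the completion of a Noetherian local ring. -/
structure IsCompletionLike (R Q : Type*) [CommRing R] [IsLocalRing R] [CommRing Q] [IsLocalRing Q]
    [Algebra R Q] : Prop where
  flat : Module.Flat R Q
  map_eq : maximalIdeal Q = (maximalIdeal R).map (algebraMap R Q)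
  mem_pow : ∀ {n : ℕ} {r : R}, algebraMap R Q r ∈ maximalIdeal Q ^ n → r ∈ maximalIdeal R ^ n
  exists_sub_mem : ∀ (x : Q) (n : ℕ), ∃ r : R, x - algebraMap R Q r ∈ maximalIdeal Q ^ n

lemma isCompletionLike_completion (R : Type*) [CommRing R] [IsLocalRing R] [IsNoetherianRing R] :
    IsCompletionLike R (Completion R) := by
  have key : ∀ (n : ℕ) (x : Completion R), x ∈ maximalIdeal (Completion R) ^ n ↔
      AdicCompletion.eval (maximalIdeal R) R n x = 0 := fun n x => by
    rw [← LinearMap.mem_ker, ← AdicCompletion.pow_smul_top_eq_ker_eval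
      (maximalIdeal R).fg_of_isNoetherianRing, AdicCompletion.maximalIdeal_eq_map, ← Ideal.map_pow,
      Ideal.smul_top_eq_map, Submodule.restrictScalars_mem]
  refine ⟨AdicCompletion.flat_of_isNoetherian _, AdicCompletion.maximalIdeal_eq_map, ?_, ?_⟩
  · intro n r hr
    rw [key] at hr
    change AdicCompletion.eval (maximalIdeal R) R n (AdicCompletion.of (maximalIdeal R) R r) = 0 at hr
    rwa [AdicCompletion.eval_of, Submodule.mkQ_apply, Submodule.Quotient.mk_eq_zero, smul_eq_mul,
      Ideal.mul_top] at hr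
  · intro x n
    obtain ⟨r, hr⟩ := Submodule.mkQ_surjective _ (AdicCompletion.eval (maximalIdeal R) R n x)
    refine ⟨r, (key _ _).2 ?_⟩
    rw [map_sub, ← hr]
    change _ - AdicCompletion.eval (maximalIdeal R) R n (AdicCompletion.of (maximalIdeal R) R r) = 0
    rw [AdicCompletion.eval_of, sub_self]

namespace IsCompletionLike

variable {R Q : Type*} [CommRing R] [IsLocalRing R] [CommRing Q] [IsLocalRing Q] [Algebra R Q]

lemma map_mem (h : IsCompletionLike R Q) {r : R} (hr : r ∈ maximalIdeal R) :
    algebraMap R Q r ∈ maximalIdeal Q := by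
  rw [h.map_eq]
  exact Ideal.mem_map_of_mem _ hr

lemma mem_of_map_mem (h : IsCompletionLike R Q) {r : R} (hr : algebraMap R Q r ∈ maximalIdeal Q) :
    r ∈ maximalIdeal R := by
  have := h.mem_pow (n := 1) (r := r) (by rwa [pow_one])
  rwa [pow_one] at this

lemma mul_eq_zero_of_socle (h : IsCompletionLike R Q) {z : Q}
    (hz : ∀ y ∈ maximalIdeal R, algebraMap R Q y * z = 0) : ∀ y ∈ maximalIdeal Q, y * z = 0 := by
  intro y hy
  rw [h.map_eq] at hy
  induction hy using Submodule.span_induction with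
  | mem y hy =>
    obtain ⟨r, hr, rfl⟩ := hy
    exact hz r hr
  | zero => rw [zero_mul]
  | add a b _ _ ha hb => rw [add_mul, ha, hb, add_zero]
  | smul c a _ ha => rw [smul_eq_mul, mul_assoc, ha, mul_zero]

lemma map_socle (h : IsCompletionLike R Q) {z : R}
    (hz : ∀ y ∈ maximalIdeal R, y * z = 0) :
    ∀ y ∈ maximalIdeal Q, y * algebraMap R Q z = 0 :=
  h.mul_eq_zero_of_socle fun y hy => by rw [← map_mul, hz y hy, map_zero]

/-- By flatness the socle of the completion is generated by the socle of the ring. -/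
lemma exists_socle_sum (h : IsCompletionLike R Q) [IsNoetherianRing R] {z : Q}
    (hz : ∀ y ∈ maximalIdeal Q, y * z = 0) :
    ∃ (k : ℕ) (a : Fin k → R) (b : Fin k → Q), (∀ i, ∀ y ∈ maximalIdeal R, y * a i = 0) ∧
      z = ∑ i, b i * algebraMap R Q (a i) := by
  have := h.flat
  -- A socle element is a map from the residue field. By flatness it factors through a finite free
  -- module, where the coordinates of the image of `1` are socle elements of `R`.
  let l : R ⧸ maximalIdeal R →ₗ[R] Q :=
    (maximalIdeal R).liftQ (LinearMap.toSpanSingleton R Q z) fun y hy => by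
      rw [LinearMap.mem_ker, LinearMap.toSpanSingleton_apply, Algebra.smul_def]
      exact hz _ (h.map_mem hy)
  have : Module.FinitePresentation R (R ⧸ maximalIdeal R) :=
    Module.finitePresentation_of_finite R _
  obtain ⟨k, h₂, h₃, hl⟩ := Module.Flat.exists_factorization_of_finitePresentation l
  refine ⟨k, fun i => h₂ (Submodule.Quotient.mk 1) i, fun i => h₃ (Finsupp.single i 1), ?_, ?_⟩
  · intro i y hy
    have h1 : y • (Submodule.Quotient.mk 1 : R ⧸ maximalIdeal R) = 0 := by
      rw [← Submodule.Quotient.mk_smul, Submodule.Quotient.mk_eq_zero, smul_eq_mul, mul_one]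
      exact hy
    have h2 := congrArg (fun v => v i) (congrArg h₂ h1)
    simpa using h2
  · have h1 : l (Submodule.Quotient.mk 1) = z := by
      change (1 : R) • z = z
      rw [one_smul]
    rw [← h1, hl, LinearMap.comp_apply]
    conv_lhs => rw [← Finsupp.univ_sum_single (h₂ (Submodule.Quotient.mk 1))]
    rw [map_sum]
    refine Finset.sum_congr rfl fun i _ => ?_
    rw [mul_comm, ← Algebra.smul_def, ← map_smul, Finsupp.smul_single, smul_eq_mul, mul_one]

/-- One summand `b i * a i` of the socle element pairs nontrivially with `x`. Move `b i` to the
other side; then `b i * x` matters only modulo the square of the maximal ideal, so it may be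
replaced by an element of `R`. -/
lemma socleSymmSqNeZero_of_completion (h : IsCompletionLike R Q) [IsNoetherianRing R]
    (hQ : SocleSymmSqNeZero Q) : SocleSymmSqNeZero R := by
  obtain ⟨z, hz, hz0, x, hx, hzx⟩ := hQ.exists_univPairing_ne_zero
  obtain ⟨k, a, b, ha, rfl⟩ := h.exists_socle_sum hz0
  have hP := isSymmPairing_univPairing (Q := Q)
  have ham : ∀ i, a i ∈ maximalIdeal R := by
    intro i
    by_contra hi
    have hu : IsUnit (a i) := by simpa using hi
    have hm : maximalIdeal R = ⊥ := eq_bot_iff.2 fun y hy => (hu.mul_left_eq_zero).1 (ha i y hy)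
    have hx' := hx
    rw [h.map_eq, hm, Ideal.map_bot, Ideal.mem_bot] at hx'
    rw [hx', hP.zero_right hz] at hzx
    exact hzx rfl
  have hab : ∀ i, b i * algebraMap R Q (a i) ∈ maximalIdeal Q := fun i =>
    Ideal.mul_mem_left _ _ (h.map_mem (ham i))
  have hsum : ∀ s : Finset (Fin k), univPairing (∑ i ∈ s, b i * algebraMap R Q (a i)) x =
      ∑ i ∈ s, univPairing (b i * algebraMap R Q (a i)) x := by
    classical
    intro s
    induction s using Finset.induction_on with
    | empty => simp [hP.zero_left hx]
    | insert i s hi ih =>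
      rw [Finset.sum_insert hi, Finset.sum_insert hi,
        hP.add_left _ (hab i) _ (sum_mem fun j _ => hab j) _ hx, ih]
  rw [hsum] at hzx
  obtain ⟨i, -, hi⟩ := Finset.exists_ne_zero_of_sum_ne_zero hzx
  rw [hP.mul_left _ _ (h.map_mem (ham i)) _ hx] at hi
  obtain ⟨x', hx'⟩ := h.exists_sub_mem (b i * x) 2
  have hx1 : algebraMap R Q x' ∈ maximalIdeal Q := by
    have := sub_mem (Ideal.mul_mem_left _ (b i) hx) (Ideal.pow_le_self two_ne_zero hx')
    rwa [sub_sub_cancel] at this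
  refine .of_pairing (hP.comp (algebraMap R Q) fun _ => h.map_mem) (ham i) (ha i)
    (h.mem_of_map_mem hx1) (x := x') ?_
  have h1 := hP.add_right (h.map_mem (ham i)) (Ideal.pow_le_self two_ne_zero hx') hx1
  rw [sub_add_cancel, hP.eq_zero_of_mem_sq (h.map_mem (ham i)) (h.map_socle (ha i)) hx',
    zero_add] at h1
  rwa [← h1]

lemma univPairing_mem_pow_smul_top {n : ℕ} {x y : R} (hx : x ∈ maximalIdeal R ^ (n + 1))
    (hy : y ∈ maximalIdeal R) : univPairing x y ∈ (maximalIdeal R ^ n •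
      ⊤ : Submodule R ((maximalIdeal R ⊗[R] maximalIdeal R) ⧸ symmRel R)) := by
  rw [pow_succ] at hx
  refine (Submodule.mul_induction_on (C := fun x => x ∈ maximalIdeal R ∧ univPairing x y ∈ _)
    hx ?_ ?_).2
  · intro a ha b hb
    refine ⟨Ideal.mul_mem_left _ _ hb, ?_⟩
    rw [univPairing_mul_left a hb hy]
    exact Submodule.smul_mem_smul ha trivial
  · rintro a b ⟨ha, ha'⟩ ⟨hb, hb'⟩
    refine ⟨add_mem ha hb, ?_⟩
    rw [isSymmPairing_univPairing.add_left a ha b hb y hy]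
    exact add_mem ha' hb'

/-- Krull's intersection theorem keeps the product nonzero modulo some `m ^ n`. There the universal
pairing of `R` extends to `Q` through approximations modulo the power `n + 1`. -/
lemma socleSymmSqNeZero_completion (h : IsCompletionLike R Q) [IsNoetherianRing R]
    (hR : SocleSymmSqNeZero R) : SocleSymmSqNeZero Q := by
  obtain ⟨z, hz, hz0, x, hx, hzx⟩ := hR.exists_univPairing_ne_zero
  have hP := isSymmPairing_univPairing (Q := R)
  have hK := Ideal.iInf_pow_smul_eq_bot_of_isLocalRing
    (M := (maximalIdeal R ⊗[R] maximalIdeal R) ⧸ symmRel R) (maximalIdeal R)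
    (maximalIdeal.isMaximal R).ne_top
  obtain ⟨n, hn⟩ : ∃ n : ℕ, univPairing z x ∉ (maximalIdeal R ^ n •
      ⊤ : Submodule R ((maximalIdeal R ⊗[R] maximalIdeal R) ⧸ symmRel R)) := by
    by_contra! hcon
    have : univPairing z x ∈ (⊥ : Submodule R ((maximalIdeal R ⊗[R] maximalIdeal R) ⧸ symmRel R)) := by
      rw [← hK]
      exact Submodule.mem_iInf _ |>.2 hcon
    exact hzx this
  set N := (maximalIdeal R ^ n •
      ⊤ : Submodule R ((maximalIdeal R ⊗[R] maximalIdeal R) ⧸ symmRel R))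
  choose s hs using fun q : Q => h.exists_sub_mem q (n + 1)
  have hs' : ∀ q, q - algebraMap R Q (s q) ∈ maximalIdeal Q := fun q =>
    Ideal.pow_le_self (Nat.succ_ne_zero n) (hs q)
  have hsm : ∀ {q}, q ∈ maximalIdeal Q → s q ∈ maximalIdeal R := fun {q} hq => by
    have := sub_mem hq (hs' q)
    rw [sub_sub_cancel] at this
    exact h.mem_of_map_mem this
  have hcongr : ∀ {a b c : R}, a ∈ maximalIdeal R → b ∈ maximalIdeal R → c ∈ maximalIdeal R →
      algebraMap R Q a - algebraMap R Q b ∈ maximalIdeal Q ^ (n + 1) →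
      N.mkQ (univPairing a c) = N.mkQ (univPairing b c) := by
    intro a b c ha hb hc hab
    rw [← sub_eq_zero, ← map_sub, ← hP.sub_left ha hb hc, Submodule.mkQ_apply,
      Submodule.Quotient.mk_eq_zero]
    rw [← map_sub] at hab
    exact univPairing_mem_pow_smul_top (h.mem_pow hab) hc
  have hss : ∀ a, algebraMap R Q (s (algebraMap R Q a)) - algebraMap R Q a ∈
      maximalIdeal Q ^ (n + 1) := fun a => by
    rw [← neg_sub]
    exact neg_mem (hs _)
  have hcongr_mul : ∀ (r : Q) {a b : Q}, a ∈ maximalIdeal Q → b ∈ maximalIdeal Q →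
      N.mkQ (univPairing (s (r * a)) (s b)) = N.mkQ (univPairing (s r * s a) (s b)) := by
    intro r a b ha hb
    refine hcongr (hsm (Ideal.mul_mem_left _ _ ha)) (Ideal.mul_mem_left _ _ (hsm ha)) (hsm hb) ?_
    have h1 := Ideal.mul_mem_left _ (algebraMap R Q (s r)) (hs a)
    have h2 := Ideal.mul_mem_right a _ (hs r)
    have h3 := hs (r * a)
    rw [map_mul]
    convert! sub_mem (add_mem h1 h2) h3 using 1
    ring
  refine .of_pairing (β := fun a b => N.mkQ (univPairing (s a) (s b))) ⟨?_, ?_, ?_⟩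
    (z := algebraMap R Q z) (x := algebraMap R Q x) (h.map_mem hz) (h.map_socle hz0) (h.map_mem hx) ?_
  · intro a ha a' ha' b hb
    rw [← map_add, ← hP.add_left _ (hsm ha) _ (hsm ha') _ (hsm hb)]
    refine hcongr (hsm (add_mem ha ha')) (add_mem (hsm ha) (hsm ha')) (hsm hb) ?_
    rw [map_add]
    convert! sub_mem (add_mem (hs a) (hs a')) (hs (a + a')) using 1
    ring
  · intro a ha b hb
    rw [hP.symm _ (hsm ha) _ (hsm hb)]
  · intro r a ha b hb
    rw [hcongr_mul r ha hb, hP.symm _ (hsm ha) _ (hsm (Ideal.mul_mem_left _ _ hb)),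
      hcongr_mul r hb ha, hP.mul_left _ _ (hsm ha) _ (hsm hb),
      hP.symm _ (hsm ha) _ (Ideal.mul_mem_left _ _ (hsm hb))]
  · rw [hcongr (hsm (h.map_mem hz)) hz (hsm (h.map_mem hx)) (hss z),
      hP.symm _ hz _ (hsm (h.map_mem hx)), hcongr (hsm (h.map_mem hx)) hx hz (hss x),
      hP.symm _ hx _ hz, Ne, Submodule.mkQ_apply, Submodule.Quotient.mk_eq_zero]
    exact hn

lemma socleSymmSqNeZero_iff (h : IsCompletionLike R Q) [IsNoetherianRing R] :
    SocleSymmSqNeZero Q ↔ SocleSymmSqNeZero R :=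
  ⟨h.socleSymmSqNeZero_of_completion, h.socleSymmSqNeZero_completion⟩

end IsCompletionLike

end Burch

/-! ### Burch rings, depth and the socle condition -/

namespace Burch

open IsLocalRing RingTheory.Sequence

lemma SocleSymmSqNeZero.exists_socle_ne_zero {Q : Type*} [CommRing Q] [IsLocalRing Q]
    (h : SocleSymmSqNeZero Q) :
    ∃ z : Q, z ≠ 0 ∧ ∀ y ∈ maximalIdeal Q, y * z = 0 := by
  obtain ⟨z, -, hz0, x, hx, hzx⟩ := h.exists_univPairing_ne_zero
  refine ⟨z, fun h0 => hzx ?_, hz0⟩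
  rw [h0, isSymmPairing_univPairing.zero_left hx]

lemma depth_eq_zero_of_socle {R : Type*} [CommRing R] [IsLocalRing R] {z : R} (hz : z ≠ 0)
    (hz0 : ∀ y ∈ maximalIdeal R, y * z = 0) : depth R = 0 := by
  rw [depth, ← nonpos_iff_eq_zero]
  refine iSup₂_le fun rs hrs => ?_
  rcases rs with _ | ⟨r, rs⟩
  · simp
  · have h1 := ((isWeaklyRegular_cons_iff R r rs).1 hrs.2.toIsWeaklyRegular).1
    refine absurd (h1 (?_ : r • z = r • 0)) hz
    rw [smul_zero, smul_eq_mul]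
    exact hz0 r (hrs.1 r (by simp))

lemma SocleSymmSqNeZero.depth_eq_zero {R : Type*} [CommRing R] [IsLocalRing R]
    (h : SocleSymmSqNeZero R) : depth R = 0 := by
  obtain ⟨z, hz, hz0⟩ := h.exists_socle_ne_zero
  exact depth_eq_zero_of_socle hz hz0

/-- A criterion for Burch rings in terms of the quotient of the completion by a regular sequence. -/
lemma isBurchRing_of_socleSymmSqNeZero {R : Type u} [CommRing R] [IsLocalRing R]
    [IsNoetherianRing R] {xs : List (Completion R)} (hxs : IsRegular (Completion R) xs)
    (hlen : (xs.length : ℕ∞) = depth R) {Q : Type u} [CommRing Q] [IsLocalRing Q]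
    {g : Completion R →+* Q} (hg : Function.Surjective g) (hker : RingHom.ker g = Ideal.ofList xs)
    (hQ : SocleSymmSqNeZero Q) : IsBurchRing R := by
  refine ⟨xs, hxs, fun y hy => ?_, hlen, ?_⟩
  -- Maximality: a unit `y` would generate the whole ring, and a nonunit kills a nonzero socle
  -- element of the quotient.
  · obtain ⟨z, hz, hz0⟩ := hQ.exists_socle_ne_zero
    obtain ⟨z, rfl⟩ := hg z
    have hym : y ∈ maximalIdeal (Completion R) := by
      by_contra hy'
      have hu : IsUnit y := by simpa using hy'
      refine hy.top_ne_smul ?_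
      rw [Ideal.ofList_append, Ideal.ofList_singleton, Ideal.span_singleton_eq_top.2 hu, sup_top_eq,
        smul_eq_mul, Ideal.top_mul]
    have h1 := (isWeaklyRegular_singleton_iff _ _).1
      ((isWeaklyRegular_append_iff _ _ _).1 hy.toIsWeaklyRegular).2
    have hmem : ∀ a : Completion R,
        (Submodule.Quotient.mk a : Completion R ⧸ (Ideal.ofList xs • ⊤ : Ideal (Completion R))) = 0 ↔
          g a = 0 := fun a => by
      rw [Submodule.Quotient.mk_eq_zero, smul_eq_mul, Ideal.mul_top, ← hker, RingHom.mem_ker]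
    refine hz ((hmem z).1 (h1 ?_))
    change y • _ = y • _
    rw [smul_zero, ← Submodule.Quotient.mk_smul, hmem, smul_eq_mul, map_mul]
    exact hz0 _ ((map_mem_maximalIdeal_iff_of_surjective hg).2 hym)
  · obtain ⟨A, _, _, f, ⟨rs, hrs, hm⟩, hf⟩ := exists_regular_surjection (Completion R) (by
      rw [AdicCompletion.maximalIdeal_eq_map]
      exact (maximalIdeal R).fg_of_isNoetherianRing.map _)
    have hgf : Function.Surjective (g.comp f) := hg.comp hf
    exact ⟨A, inferInstance, inferInstance, RingHom.ker (g.comp f), hQ.isBurchIdeal hrs hm hgf,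
      ⟨((Ideal.quotEquivOfEq hker.symm).trans (RingHom.quotientKerEquivOfSurjective hg)).trans
        (RingHom.quotientKerEquivOfSurjective hgf).symm⟩⟩

lemma IsCompletionLike.not_isField {R Q : Type*} [CommRing R] [IsLocalRing R] [IsNoetherianRing R]
    [CommRing Q] [IsLocalRing Q] [Algebra R Q] (h : IsCompletionLike R Q) (hR : ¬ IsField R) :
    ¬ IsField Q := by
  rw [IsLocalRing.isField_iff_maximalIdeal_eq] at hR ⊢
  intro hQ
  refine hR (eq_bot_iff.2 fun r hr => ?_)
  have h1 := h.map_mem hr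
  rw [hQ, Ideal.mem_bot] at h1
  have h2 : r ∈ ⨅ i : ℕ, maximalIdeal R ^ i :=
    Ideal.mem_iInf.2 fun n => h.mem_pow (by rw [h1]; exact zero_mem _)
  rwa [Ideal.iInf_pow_eq_bot_of_isLocalRing _ (maximalIdeal.isMaximal R).ne_top] at h2

/-- In depth zero, the Burch property is detected by the symmetric square of the maximal ideal. -/
theorem isBurchRing_and_depth_eq_zero_iff {R : Type u} [CommRing R] [IsLocalRing R]
    [IsNoetherianRing R] (hR : ¬ IsField R) :
    (IsBurchRing R ∧ depth R = 0) ↔ SocleSymmSqNeZero R := by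
  have hC := isCompletionLike_completion R
  constructor
  · rintro ⟨⟨xs, -, -, hlen, A, _, _, I, hI, ⟨e⟩⟩, hd⟩
    rw [hd] at hlen
    obtain rfl : xs = [] := List.length_eq_zero_iff.1 (by exact_mod_cast hlen)
    let g : Completion R ⧸ Ideal.ofList ([] : List (Completion R)) ≃+* Completion R :=
      (Ideal.quotEquivOfEq Ideal.ofList_nil).trans (RingEquiv.quotientBot _)
    let f : A →+* Completion R := ((e.symm.trans g : A ⧸ I ≃+* Completion R) :
      A ⧸ I →+* Completion R).comp (Ideal.Quotient.mk I)
    have hf : Function.Surjective f := (e.symm.trans g).surjective.comp Ideal.Quotient.mk_surjective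
    have hker : RingHom.ker f = I := by
      ext a
      rw [RingHom.mem_ker, RingHom.comp_apply, RingEquiv.coe_toRingHom, map_eq_zero_iff _
        (e.symm.trans g).injective, Ideal.Quotient.eq_zero_iff_mem]
    refine hC.socleSymmSqNeZero_iff.1 (.of_isBurchIdeal hf (hC.not_isField hR) ?_)
    rwa [hker]
  · intro h
    refine ⟨isBurchRing_of_socleSymmSqNeZero (xs := []) (IsRegular.nil _ _) ?_
      (g := RingHom.id _) Function.surjective_id ?_ (hC.socleSymmSqNeZero_iff.2 h), h.depth_eq_zero⟩
    · rw [h.depth_eq_zero, List.length_nil, Nat.cast_zero]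
    · rw [Ideal.ofList_nil]
      ext
      simp

lemma exists_regular_of_depth_pos {R : Type*} [CommRing R] [IsLocalRing R] (h : 0 < depth R) :
    ∃ r ∈ maximalIdeal R, IsSMulRegular R r := by
  simp only [depth, lt_iSup_iff] at h
  obtain ⟨rs, hrs, h⟩ := h
  rcases rs with _ | ⟨r, rs⟩
  · simp at h
  · exact ⟨r, hrs.1 r (by simp), ((isWeaklyRegular_cons_iff R r rs).1 hrs.2.toIsWeaklyRegular).1⟩

lemma isRegular_singleton_of_mem {R : Type*} [CommRing R] [IsLocalRing R] {r : R}
    (hr : r ∈ maximalIdeal R) (hreg : IsSMulRegular R r) : IsRegular R [r] := by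
  refine ⟨(isWeaklyRegular_singleton_iff _ _).2 hreg, fun h => ?_⟩
  rw [Ideal.ofList_singleton, smul_eq_mul, Ideal.mul_top] at h
  exact hr (Ideal.span_singleton_eq_top.1 h.symm)

/-- The depth is one if every regular quotient by one element has nonzero socle. -/
lemma depth_eq_one {R : Type*} [CommRing R] [IsLocalRing R] (hpos : 0 < depth R)
    (h : ∀ r ∈ maximalIdeal R, IsSMulRegular R r →
      ∃ z ∉ Ideal.span {r}, ∀ y ∈ maximalIdeal R, y * z ∈ Ideal.span {r}) : depth R = 1 := by
  refine le_antisymm ?_ (Order.one_le_iff_pos.2 hpos)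
  rw [depth]
  refine iSup₂_le fun rs hrs => ?_
  rcases rs with _ | ⟨r, _ | ⟨y, rs⟩⟩
  · simp
  · simp
  · obtain ⟨h1, h2⟩ := (isWeaklyRegular_cons_iff R _ _).1 hrs.2.toIsWeaklyRegular
    have h3 := ((isWeaklyRegular_cons_iff _ _ _).1 h2).1
    obtain ⟨z, hz, hz0⟩ := h r (hrs.1 r (by simp)) h1
    have hmem : ∀ a : R, (Submodule.Quotient.mk a : QuotSMulTop r R) = 0 ↔ a ∈ Ideal.span {r} :=
      fun a => by
        rw [Submodule.Quotient.mk_eq_zero, ← Submodule.ideal_span_singleton_smul, smul_eq_mul,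
          Ideal.mul_top]
    refine absurd ((hmem z).1 (h3 ?_)) hz
    change y • _ = y • _
    rw [smul_zero, ← Submodule.Quotient.mk_smul, hmem]
    exact hz0 y (hrs.1 y (by simp))

/-! ### Fibre products of positive depth -/

namespace IsLocalFibre

variable {R : Type u} {S T : Type*} [CommRing R] [IsLocalRing R] [CommRing S] [IsLocalRing S]
  [CommRing T] [IsLocalRing T] {p : R →+* S} {q : R →+* T}

/-- `R` embeds as an `R`-module in `S × T`, whose factors are Noetherian as quotients of `R`. -/
lemma isNoetherianRing (h : IsLocalFibre p q) [IsNoetherianRing S] [IsNoetherianRing T] :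
    IsNoetherianRing R := by
  let := p.toAlgebra
  let := q.toAlgebra
  have hS : IsNoetherian R S := by
    have : RingHomSurjective (algebraMap R S) := ⟨h.surj_left⟩
    let f : S →ₛₗ[algebraMap R S] S := ⟨⟨id, fun _ _ => rfl⟩, fun r s => Algebra.smul_def r s⟩
    exact (LinearMap.isNoetherian_iff_of_bijective f Function.bijective_id).2 inferInstance
  have hT : IsNoetherian R T := by
    have : RingHomSurjective (algebraMap R T) := ⟨h.surj_right⟩
    let f : T →ₛₗ[algebraMap R T] T := ⟨⟨id, fun _ _ => rfl⟩, fun r s => Algebra.smul_def r s⟩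
    exact (LinearMap.isNoetherian_iff_of_bijective f Function.bijective_id).2 inferInstance
  refine isNoetherian_of_injective (Algebra.linearMap R (S × T)) fun x y hxy => ?_
  exact h.ext x y (congrArg Prod.fst hxy) (congrArg Prod.snd hxy)

lemma not_isField (h : IsLocalFibre p q) (hS : ¬ IsField S) : ¬ IsField R := by
  rw [IsLocalRing.isField_iff_maximalIdeal_eq] at hS ⊢
  intro hR
  refine hS (eq_bot_iff.2 fun s hs => ?_)
  obtain ⟨x, rfl⟩ := h.surj_left s
  have := h.mem_left_iff.1 hs
  rw [hR, Ideal.mem_bot] at this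
  rw [this, map_zero]
  exact zero_mem _

lemma map_left_ne_zero (h : IsLocalFibre p q) (hS : ¬ IsField S) {r : R}
    (hreg : IsSMulRegular R r) : p r ≠ 0 := by
  intro h0
  rw [IsLocalRing.isField_iff_maximalIdeal_eq] at hS
  obtain ⟨s, hs, hs0⟩ := Submodule.exists_mem_ne_zero_of_ne_bot hS
  obtain ⟨x, rfl, hx⟩ := h.lift_left s hs
  refine hs0 ?_
  rw [hreg (h.ext (r • x) (r • 0) (by simp [h0]) (by simp [hx])), map_zero]

/-- The element with the same first coordinate as `r` and second coordinate zero lies in the socle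
modulo `r`. -/
lemma exists_socle_mod (h : IsLocalFibre p q) {r : R} (hr : r ∈ maximalIdeal R) :
    ∃ z ∈ maximalIdeal R, p z = p r ∧ q z = 0 ∧ ∀ y ∈ maximalIdeal R, y * z ∈ Ideal.span {r} := by
  obtain ⟨z, hz, hz'⟩ := h.lift_left _ (h.mem_left_iff.2 hr)
  refine ⟨z, h.mem_left_iff.1 (by rw [hz]; exact h.mem_left_iff.2 hr), hz, hz', fun y hy => ?_⟩
  obtain ⟨y', hy1, hy2⟩ := h.lift_left _ (h.mem_left_iff.2 hy)
  exact Ideal.mem_span_singleton'.2 ⟨y', h.ext _ _ (by simp [hy1, hz]) (by simp [hy2, hz'])⟩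

/-- The element `(p r, 0)` is in the socle modulo `r`. It is not `c r`: a unit `c` would give `q r =
0`, a nonunit `c` would give `p r = 0`. -/
lemma depth_eq_one (h : IsLocalFibre p q) (hS : ¬ IsField S) (hT : ¬ IsField T)
    (hpos : 0 < depth R) : depth R = 1 := by
  refine Burch.depth_eq_one hpos fun r hr hreg => ?_
  obtain ⟨z, -, hz1, hz2, hz0⟩ := h.exists_socle_mod hr
  refine ⟨z, fun hz => ?_, hz0⟩
  obtain ⟨c, rfl⟩ := Ideal.mem_span_singleton'.1 hz
  have hp := h.map_left_ne_zero hS hreg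
  have hq := h.swap.map_left_ne_zero hT hreg
  rw [map_mul] at hz1 hz2
  by_cases hc : IsUnit c
  · exact hq ((hc.map q).mul_right_eq_zero.1 hz2)
  · have hc' : 1 - p c ∉ nonunits S := by
      intro h1
      have h2 : p c ∈ maximalIdeal S := h.mem_left_iff.2 hc
      have := add_mem (show 1 - p c ∈ maximalIdeal S from h1) h2
      rw [sub_add_cancel] at this
      exact (Ideal.ne_top_iff_one _).1 (maximalIdeal.isMaximal S).ne_top this
    rw [mem_nonunits_iff, not_not] at hc'
    refine hp (hc'.mul_right_eq_zero.1 ?_)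
    rw [sub_mul, one_mul, hz1, sub_self]

lemma maximalIdeal_ne_sq {A : Type*} [CommRing A] [IsLocalRing A] [IsNoetherianRing A]
    (hA : ¬ IsField A) : ¬ maximalIdeal A ≤ maximalIdeal A ^ 2 := by
  intro hle
  rw [IsLocalRing.isField_iff_maximalIdeal_eq] at hA
  refine hA (Submodule.eq_bot_of_le_smul_of_le_jacobson_bot (maximalIdeal A) _
    (IsNoetherian.noetherian _) (by rwa [smul_eq_mul, ← pow_two]) (maximalIdeal_le_jacobson _))

/-- Prime avoidance over the associated primes together with the preimages of the two squares; two
nonprime ideals are allowed. -/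
lemma exists_regular_notMem_sq (h : IsLocalFibre p q) [IsNoetherianRing S] [IsNoetherianRing T]
    (hS : ¬ IsField S) (hT : ¬ IsField T) (hpos : 0 < depth R) :
    ∃ r ∈ maximalIdeal R, IsSMulRegular R r ∧ p r ∉ maximalIdeal S ^ 2 ∧
      q r ∉ maximalIdeal T ^ 2 := by
  classical
  have := h.isNoetherianRing
  obtain ⟨r₀, hr₀, hreg₀⟩ := exists_regular_of_depth_pos hpos
  by_contra! hcon
  set a := (maximalIdeal S ^ 2).comap p
  set b := (maximalIdeal T ^ 2).comap q
  have hfin := associatedPrimes.finite R R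
  have hsub : (maximalIdeal R : Set R) ⊆
      ⋃ i ∈ ((insert a (insert b hfin.toFinset) : Finset (Ideal R)) : Set (Ideal R)),
        ((id i : Ideal R) : Set R) := by
    intro r hr
    by_cases hreg : IsSMulRegular R r
    · by_cases hp : p r ∈ maximalIdeal S ^ 2
      · exact Set.mem_biUnion (by simp : a ∈ _) hp
      · exact Set.mem_biUnion (by simp : b ∈ _) (hcon r hr hreg hp)
    · have : r ∈ ⋃ P ∈ associatedPrimes R R, (P : Set R) := by
        rw [biUnion_associatedPrimes_eq_compl_regular]
        exact hreg
      obtain ⟨P, hP, hrP⟩ := Set.mem_iUnion₂.1 this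
      exact Set.mem_biUnion (by simp [hP] : P ∈ _) hrP
  rw [Ideal.subset_union_prime a b (by
    intro P hP ha hb
    simp only [Finset.mem_insert, ha, hb, false_or, Set.Finite.mem_toFinset] at hP
    exact hP.isPrime)] at hsub
  obtain ⟨P, hP, hle⟩ := hsub
  simp only [Finset.mem_insert, Set.Finite.mem_toFinset] at hP
  rcases hP with rfl | rfl | hP
  · refine maximalIdeal_ne_sq hS fun s hs => ?_
    obtain ⟨x, rfl⟩ := h.surj_left s
    exact hle (h.mem_left_iff.1 hs)
  · refine maximalIdeal_ne_sq hT fun s hs => ?_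
    obtain ⟨x, rfl⟩ := h.surj_right s
    exact hle (h.mem_right_iff.1 hs)
  · have h1 : r₀ ∈ ⋃ P ∈ associatedPrimes R R, (P : Set R) := Set.mem_biUnion hP (hle hr₀)
    rw [biUnion_associatedPrimes_eq_compl_regular] at h1
    exact h1 hreg₀

lemma map_mem_sq {A B : Type*} [CommRing A] [IsLocalRing A] [CommRing B] [IsLocalRing B]
    {f : A →+* B} (hf : Function.Surjective f) {x : A} (hx : x ∈ maximalIdeal A ^ 2) :
    f x ∈ maximalIdeal B ^ 2 := by
  have h1 : (maximalIdeal A).map f ≤ maximalIdeal B := Ideal.map_le_iff_le_comap.2 fun a ha =>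
    (map_mem_maximalIdeal_iff_of_surjective hf).2 ha
  have h2 := Ideal.mem_map_of_mem f hx
  rw [Ideal.map_pow] at h2
  exact Ideal.pow_right_mono h1 2 h2

/-- A fibre product of positive depth is a Burch ring. -/
theorem isBurchRing_of_depth_pos (h : IsLocalFibre p q) [IsNoetherianRing S] [IsNoetherianRing T]
    (hS : ¬ IsField S) (hT : ¬ IsField T) (hpos : 0 < depth R) : IsBurchRing R := by
  have := h.isNoetherianRing
  have hC := isCompletionLike_completion R
  have := hC.flat
  obtain ⟨r, hr, hreg, hp, hq⟩ := h.exists_regular_notMem_sq hS hT hpos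
  obtain ⟨z, hzm, hz1, hz2, hz0⟩ := h.exists_socle_mod hr
  set ι := algebraMap R (Completion R)
  have hne : Ideal.ofList [ι r] ≠ ⊤ := by
    rw [Ideal.ofList_singleton, Ne, Ideal.span_singleton_eq_top]
    exact hC.map_mem hr
  have : Nontrivial (Completion R ⧸ Ideal.ofList [ι r]) := Ideal.Quotient.nontrivial_iff.2 hne
  set g := Ideal.Quotient.mk (Ideal.ofList [ι r])
  have hg : Function.Surjective g := Ideal.Quotient.mk_surjective
  have : IsLocalRing (Completion R ⧸ Ideal.ofList [ι r]) := .of_surjective' g hg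
  have hgm : ∀ {x}, g x ∈ maximalIdeal _ ↔ x ∈ maximalIdeal (Completion R) :=
    map_mem_maximalIdeal_iff_of_surjective hg
  have hgr : ∀ {x}, x ∈ Ideal.span {r} → g (ι x) = 0 := by
    intro x hx
    obtain ⟨c, rfl⟩ := Ideal.mem_span_singleton'.1 hx
    rw [Ideal.Quotient.eq_zero_iff_mem, Ideal.ofList_singleton, map_mul]
    exact Ideal.mul_mem_left _ _ (Ideal.mem_span_singleton_self _)
  refine isBurchRing_of_socleSymmSqNeZero (xs := [ι r]) (g := g)
    (isRegular_singleton_of_mem (hC.map_mem hr) (IsSMulRegular.of_flat hreg)) ?_ hg Ideal.mk_ker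
    (.of_notMem_sq (z := g (ι z)) (hgm.2 (hC.map_mem hzm)) ?_ ?_)
  · rw [h.depth_eq_one hS hT hpos]
    simp
  · intro y hy
    obtain ⟨y, rfl⟩ := hg y
    have key : ∀ y ∈ maximalIdeal (Completion R), g y * g (ι z) = 0 := by
      intro y hy
      rw [hC.map_eq] at hy
      induction hy using Submodule.span_induction with
      | mem y hy =>
        obtain ⟨a, ha, rfl⟩ := hy
        rw [← map_mul, ← map_mul, hgr (hz0 a ha)]
      | zero => rw [map_zero, zero_mul]
      | add a b _ _ ha hb => rw [map_add, add_mul, ha, hb, add_zero]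
      | smul c a _ ha => rw [smul_eq_mul, map_mul, mul_assoc, ha, mul_zero]
    exact key y (hgm.1 hy)
  · intro hsq
    have hmap : maximalIdeal (Completion R ⧸ Ideal.ofList [ι r]) =
        (maximalIdeal (Completion R)).map g := by
      refine le_antisymm (fun x hx => ?_) (Ideal.map_le_iff_le_comap.2 fun x hx => hgm.2 hx)
      obtain ⟨x, rfl⟩ := hg x
      exact Ideal.mem_map_of_mem _ (hgm.1 hx)
    rw [hmap, ← Ideal.map_pow] at hsq
    obtain ⟨w, hw, hwz⟩ := (Ideal.mem_map_iff_of_surjective g hg).1 hsq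
    rw [Ideal.Quotient.eq, Ideal.ofList_singleton] at hwz
    obtain ⟨c, hc⟩ := Ideal.mem_span_singleton'.1 hwz
    obtain ⟨c', hc'⟩ := hC.exists_sub_mem c 1
    rw [pow_one] at hc'
    -- Membership of `z` in the square modulo `r` descends from the completion, `c'` approximating
    -- the multiplier to first order. Its coordinates are `(1 + p c') p r` and `q c' q r`; one of `1
    -- + p c'` and `q c'` is a unit, contradicting the choice of `r`.
    have h1 : z + c' * r ∈ maximalIdeal R ^ 2 := by
      apply hC.mem_pow
      have h2 := Ideal.mul_mem_mul hc' (hC.map_mem hr)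
      rw [← pow_two] at h2
      convert! sub_mem hw h2 using 1
      rw [map_add, map_mul, sub_mul, hc]
      ring
    have h2 := map_mem_sq h.surj_left h1
    have h3 := map_mem_sq h.surj_right h1
    rw [map_add, map_mul, hz1, ← one_add_mul] at h2
    rw [map_add, map_mul, hz2, zero_add] at h3
    by_cases hc : IsUnit c'
    · exact hq ((Ideal.unit_mul_mem_iff_mem _ (hc.map q)).1 h3)
    · refine hp ((Ideal.unit_mul_mem_iff_mem _ ?_).1 h2)
      by_contra h4
      have h5 : p c' ∈ maximalIdeal S := h.mem_left_iff.2 hc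
      have := sub_mem (show 1 + p c' ∈ maximalIdeal S from h4) h5
      rw [add_sub_cancel_right] at this
      exact (Ideal.ne_top_iff_one _).1 (maximalIdeal.isMaximal S).ne_top this

end IsLocalFibre

lemma mem_maximalIdeal_iff_of_surjective_field {S k : Type*} [CommRing S] [IsLocalRing S] [Field k]
    {f : S →+* k} (hf : Function.Surjective f) {s : S} : s ∈ maximalIdeal S ↔ f s = 0 := by
  rw [← map_mem_maximalIdeal_iff_of_surjective hf,
    IsLocalRing.isField_iff_maximalIdeal_eq.1 (Field.toIsField k), Ideal.mem_bot]

lemma isLocalFibre_fibreProduct {S T k R : Type*} [CommRing S] [IsLocalRing S] [CommRing T]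
    [IsLocalRing T] [Field k] {πS : S →+* k} (hπS : Function.Surjective πS) {πT : T →+* k}
    (hπT : Function.Surjective πT) [CommRing R] [IsLocalRing R] (e : R ≃+* fibreProduct πS πT) :
    IsLocalFibre
      (((RingHom.fst S T).comp (fibreProduct πS πT).subtype).comp (e : R →+* fibreProduct πS πT))
      (((RingHom.snd S T).comp (fibreProduct πS πT).subtype).comp
        (e : R →+* fibreProduct πS πT)) where
  surj_left s := by
    obtain ⟨t, ht⟩ := hπT (πS s)
    exact ⟨e.symm ⟨(s, t), ht.symm⟩, by simp⟩
  surj_right t := by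
    obtain ⟨s, hs⟩ := hπS (πT t)
    exact ⟨e.symm ⟨(s, t), hs⟩, by simp⟩
  ext x y hx hy := e.injective (Subtype.ext (Prod.ext hx hy))
  lift_left s hs :=
    ⟨e.symm ⟨(s, 0), ((mem_maximalIdeal_iff_of_surjective_field hπS).1 hs).trans
      (map_zero πT).symm⟩, by simp, by simp⟩
  lift_right t ht :=
    ⟨e.symm ⟨(0, t), (map_zero πS).trans
      ((mem_maximalIdeal_iff_of_surjective_field hπT).1 ht).symm⟩, by simp, by simp⟩

end Burch

theorem mainTheorem11 {S T k R : Type*}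
    [CommRing S] [IsLocalRing S] [IsNoetherianRing S]
    [CommRing T] [IsLocalRing T] [IsNoetherianRing T]
    [Field k]
    (πS : S →+* k) (hπS : Function.Surjective πS)
    (πT : T →+* k) (hπT : Function.Surjective πT)
    (hS : ¬ IsField S) (hT : ¬ IsField T)
    [CommRing R] [IsLocalRing R] (e : R ≃+* Burch.fibreProduct πS πT) :
    Burch.IsBurchRing R ↔
      0 < Burch.depth R ∨
        (Burch.depth R = 0 ∧
          ((Burch.IsBurchRing S ∧ Burch.depth S = 0) ∨
            (Burch.IsBurchRing T ∧ Burch.depth T = 0))) := by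
  have h := Burch.isLocalFibre_fibreProduct hπS hπT e
  have := h.isNoetherianRing
  -- The disjunction over `S` and `T` becomes the single condition that `R` is Burch of depth zero,
  -- leaving only the case of positive depth.
  rw [Burch.isBurchRing_and_depth_eq_zero_iff hS, Burch.isBurchRing_and_depth_eq_zero_iff hT,
    ← h.socleSymmSqNeZero_iff, ← Burch.isBurchRing_and_depth_eq_zero_iff (h.not_isField hS)]
  constructor
  · intro hR
    rcases eq_or_ne (Burch.depth R) 0 with hd | hd
    · exact .inr ⟨hd, hR, hd⟩
    · exact .inl (pos_iff_ne_zero.2 hd)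
  · rintro (hd | ⟨-, hR, -⟩)
    · exact h.isBurchRing_of_depth_pos hS hT hd
    · exact hR
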